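/- Fix an integer $r\ge 1$. There are $K$ users; the channel vectors $\mathbf h_1,\dots,\mathbf h_K\in\mathbb C^r$ have i.i.d. entries whose real and imaginary parts are independent standard normal variables, so that $\|\mathbf h_s\|^2\sim\chi^2_{2r}$. For a threshold $u$, every user $s$ with $\|\mathbf h_s\|^2>u$ transmits; let $\mathcal S$ be the set of transmitting users. With MMSE decoding and power $P=1$, the sum capacity of a slot is $$C(u)=\sum_{i\in\mathcal S}\log\bigl(1+\mathbf h_i^\dagger\mathbf R_i\mathbf h_i\bigr)\ \text{ if } |\mathcal S|\le r,\qquad C(u)=0\ \text{ if } |\mathcal S|>r,$$ where $\mathbf R_i=(\mathbf H_{(-i)}\mathbf H_{(-i)}^\dagger+I)^{-1}$ and $\mathbf H_{(-i)}$ is the matrix whose columns are the $\mathbf h_s$, $s\in\mathcal S\setminus\{i\}$. For $k>0$ let $u_k=u_k(K)$ be the threshold that $k$ users exceed on average, i.e. $\mathrm E|\mathcal S|=k$. Write $\Gamma(s,x)=\int_x^\infty t^{s-1}e^{-t}\,dt$, $\psi=(\ln\Gamma)'$, and for $2\le j\le r$ $$B_j(u)=\left(\frac{\Gamma(r)\Gamma(r-j+1,u/2)}{\Gamma(r,u/2)\Gamma(r-j+1)}+e^{-u/2}\frac{u^{r-1}}{2^{r-1}\Gamma(r,u/2)}\right)\log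 u+e^{-u/2}\frac{u^{r-1}}{2^{r-1}\Gamma(r,u/2)}\bigl(\psi(r-j+1)-\psi(r)\bigr)+e\,\frac{\Gamma(r)\Gamma(r-j,1+u/2)}{\Gamma(r,u/2)\Gamma(r-j+1)}.$$ (1) For every $M>0$ there is $K_0=K_0(r,M)$ such that for all $K\ge K_0$ and all real $k$ with $0<k\le M$, $C(u_k)$ is integrable and $$\mathrm E[C(u_k)]>\sum_{j=2}^{r}\frac{k^je^{-k}}{j!}\,j\,B_j(u_k).$$ (2) For fixed $k>0$, as $K\to\infty$: $B_j(u_k)=\Theta(\log u_k)$ for every $2\le j\le r$, and $\log u_k=\Theta(\log\log K)$; hence, if $r\ge2$, the sum on the right-hand side of (1) is $\Theta(\log\log K)$. -/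

import Mathlib

open MeasureTheory ProbabilityTheory Filter Asymptotics

noncomputable section

/-- Law of a complex Gaussian channel coefficient: independent real and imaginary parts, each
standard normal, so that the squared norm of `r` independent coefficients is chi-square
distributed with `2r` degrees of freedom. -/
def complexGaussian : Measure ℂ :=
  ((gaussianReal 0 1).prod (gaussianReal 0 1)).map (fun p : ℝ × ℝ => (⟨p.1, p.2⟩ : ℂ))

/-- Joint law of the channel vectors of `K` users at a base station with `r` antennas: all
coefficients `H s n` (user `s`, antenna `n`) are i.i.d. complex Gaussian. -/
def channelLaw (K r : ℕ) : Measure (Fin K → Fin r → ℂ) :=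
  Measure.pi fun _ => Measure.pi fun _ => complexGaussian

/-- The squared Euclidean norm `‖h‖²` of a channel vector. -/
def channelGain {r : ℕ} (h : Fin r → ℂ) : ℝ := ∑ n, ‖h n‖ ^ 2

/-- The transmitting users: those whose squared channel norm exceeds the threshold `u`. -/
def transmitting {K r : ℕ} (u : ℝ) (H : Fin K → Fin r → ℂ) : Finset (Fin K) :=
  Finset.univ.filter fun s => u < channelGain (H s)

/-- The expected number of users whose squared channel norm exceeds `u`. -/
def expectedExceedances (K r : ℕ) (u : ℝ) : ℝ :=
  ∫ H, ((transmitting u H).card : ℝ) ∂(channelLaw K r)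

/-- The matrix `H₍₋ᵢ₎` whose columns are the channel vectors of the users in `S` other than `i`. -/
def interferenceMatrix {K r : ℕ} (H : Fin K → Fin r → ℂ) (S : Finset (Fin K)) (i : Fin K) :
    Matrix (Fin r) {s // s ∈ S.erase i} ℂ :=
  Matrix.of fun n s => H s.1 n

/-- The matrix `R = (H₍₋ᵢ₎ H₍₋ᵢ₎† + I)⁻¹`. -/
def mmseMatrix {K r : ℕ} (H : Fin K → Fin r → ℂ) (S : Finset (Fin K)) (i : Fin K) :
    Matrix (Fin r) (Fin r) ℂ :=
  (interferenceMatrix H S i * (interferenceMatrix H S i).conjTranspose + 1)⁻¹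

/-- The output SINR `hᵢ† R hᵢ` of stream `i` under MMSE decoding when the users in `S` transmit
(a real number, since `R` is Hermitian). -/
def mmseSINR {K r : ℕ} (H : Fin K → Fin r → ℂ) (S : Finset (Fin K)) (i : Fin K) : ℝ :=
  (star (H i) ⬝ᵥ (mmseMatrix H S i).mulVec (H i)).re

/-- Sum capacity (in nats) of one slot of the threshold algorithm with MMSE decoding and power
`P`: every user above the threshold transmits, and the slot is lost if more than `r` users do. -/
def slotCapacity {K r : ℕ} (P u : ℝ) (H : Fin K → Fin r → ℂ) : ℝ :=
  if (transmitting u H).card ≤ r then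
    ∑ i ∈ transmitting u H, Real.log (1 + P * mmseSINR H (transmitting u H) i)
  else 0

/-- The expected sum capacity `E[C(u)]`. -/
def expectedCapacity (K r : ℕ) (P u : ℝ) : ℝ :=
  ∫ H, slotCapacity P u H ∂(channelLaw K r)

/-- Upper incomplete Gamma function `Γ(s, x) = ∫ₓ^∞ t^(s-1) e^(-t) dt`. -/
def upperGamma (s x : ℝ) : ℝ := ∫ t in Set.Ioi x, t ^ (s - 1) * Real.exp (-t)

/-- Real digamma function `ψ(x) = d/dx ln Γ(x)`. -/
def realDigamma (x : ℝ) : ℝ := deriv (fun y => Real.log (Real.Gamma y)) x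

/-- The explicit lower bound on the expected capacity of one user when `j` users transmit. -/
def userBound (r j : ℕ) (u : ℝ) : ℝ :=
  ((Real.Gamma r * upperGamma ((r : ℝ) - j + 1) (u / 2))
        / (upperGamma r (u / 2) * Real.Gamma ((r : ℝ) - j + 1))
      + Real.exp (-(u / 2)) * (u ^ (r - 1) / (2 ^ (r - 1) * upperGamma r (u / 2)))) * Real.log u
    + Real.exp (-(u / 2)) * (u ^ (r - 1) / (2 ^ (r - 1) * upperGamma r (u / 2)))
        * (realDigamma ((r : ℝ) - j + 1) - realDigamma r)
    + Real.exp 1 * ((Real.Gamma r * upperGamma ((r : ℝ) - j) (1 + u / 2))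
        / (upperGamma r (u / 2) * Real.Gamma ((r : ℝ) - j + 1)))

/-- The lower bound on the expected sum capacity. -/
def capacityLowerBound (r : ℕ) (k u : ℝ) : ℝ :=
  ∑ j ∈ Finset.Icc 2 r, k ^ j * Real.exp (-k) / (j.factorial : ℝ) * j * userBound r j u

end

open scoped ENNReal Topology

/-! Both sides are compared with `log u`; the strict gap is the single-user term `j = 1`, which the
right-hand sum omits. Suppose a set `S` of at most `r` users transmits and `i ∈ S`. Fewer than `r`
interferers leave a unit vector `v` orthogonal to their channels, and the MMSE quadratic form is at
least `|⟨v, hᵢ⟩|²` (`quadForm_inv_bounds`). Since `v` depends only on the other users, rotation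
invariance replaces `⟨v, hᵢ⟩` by a coordinate of `hᵢ`. Conditionally on `‖hᵢ‖² > u`, that coordinate
has squared modulus below `δu` with probability at most `rδ`
(`pi_complexGaussian_first_coord_small`). So each stream contributes at least `(1 - rδ) log(1 +
δu)`, and `expectedCapacity_ge` sums this over the binomial law of `|S|`. On the other side, `B_j(u)
/ log u → 1` (`tendsto_userBound_div_log`), so the right-hand sum is about `T log u` with `T =
∑_{j≥2} j e^{-k} k^j / j!`, while the capacity is at least about `(k e^{-k} + T) log u`. Uniformity
down to `k → 0` holds because `T ≤ e^M k e^{-k}`, because the binomial weights dominate `1 - ε`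
times the Poisson weights uniformly in `k ≤ M`, and because `u ≥ 2 (log K - log M)`. The growth
orders follow from the same limit of `B_j` and from two-sided bounds on `u` linear in `log K`. -/

/-! ### The complex Gaussian law: rotation invariance and polar coordinates. -/

lemma measurable_complex_mk :
    Measurable (fun p : ℝ × ℝ => (⟨p.1, p.2⟩ : ℂ)) :=
  Complex.measurableEquivRealProd.symm.measurable

instance : IsProbabilityMeasure complexGaussian :=
  Measure.isProbabilityMeasure_map measurable_complex_mk.aemeasurable

instance (K r : ℕ) : IsProbabilityMeasure (channelLaw K r) := by
  unfold channelLaw; infer_instance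

lemma charFun_complexGaussian (t : ℂ) :
    charFun complexGaussian t = Complex.exp (-‖t‖ ^ 2 / 2) := by
  have h : ∀ p : ℝ × ℝ, Complex.exp ((inner ℝ (⟨p.1, p.2⟩ : ℂ) t : ℝ) * Complex.I)
      = Complex.exp (t.re * p.1 * Complex.I) * Complex.exp (t.im * p.2 * Complex.I) := by
    intro p
    rw [← Complex.exp_add, Complex.inner]
    congr 1
    simp
    ring
  rw [charFun_apply, complexGaussian,
    integral_map measurable_complex_mk.aemeasurable (by fun_prop)]
  simp_rw [h]
  rw [integral_prod_mul (f := fun x : ℝ => Complex.exp (t.re * x * Complex.I))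
    (g := fun x : ℝ => Complex.exp (t.im * x * Complex.I)), ← charFun_apply_real,
    ← charFun_apply_real, charFun_gaussianReal, charFun_gaussianReal, ← Complex.exp_add]
  congr 1
  have h2 : ((‖t‖ ^ 2 : ℝ) : ℂ) = t.re ^ 2 + t.im ^ 2 := by
    rw [← Complex.normSq_eq_norm_sq, Complex.normSq_apply]; push_cast; ring
  push_cast at h2 ⊢
  rw [h2]
  ring

/-- The characteristic functions agree. This gives access to the invariance of `stdGaussian` under
linear isometries. -/
lemma map_toLp_pi_complexGaussian (r : ℕ) :
    (Measure.pi fun _ : Fin r => complexGaussian).map (WithLp.toLp 2)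
      = stdGaussian (EuclideanSpace ℂ (Fin r)) := by
  apply Measure.ext_of_charFun (E := EuclideanSpace ℂ (Fin r))
  ext t
  simp_rw [charFun_stdGaussian, charFun_pi, charFun_complexGaussian, ← Complex.exp_sum]
  congr 1
  rw [← Complex.ofReal_pow, EuclideanSpace.norm_sq_eq]
  push_cast
  rw [← Finset.sum_div, Finset.sum_neg_distrib]

lemma channelGain_eq_norm_sq {r : ℕ} (h : Fin r → ℂ) :
    channelGain h = ‖WithLp.toLp 2 h‖ ^ 2 := by
  rw [EuclideanSpace.norm_sq_eq]; rfl

lemma measurable_channelGain {r : ℕ} : Measurable (channelGain (r := r)) := by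
  unfold channelGain; fun_prop

lemma channelGain_nonneg {r : ℕ} (h : Fin r → ℂ) : 0 ≤ channelGain h :=
  Finset.sum_nonneg fun _ _ => by positivity

/-- Rotation invariance: the projection on a unit vector is distributed, jointly with the norm,
like the first coordinate. -/
lemma pi_complexGaussian_rotate {m : ℕ} (v : Fin (m + 1) → ℂ) (hv : channelGain v = 1) (u t : ℝ) :
    (Measure.pi fun _ : Fin (m + 1) => complexGaussian)
        {h | u < channelGain h ∧ ‖star v ⬝ᵥ h‖ ^ 2 < t}
      = (Measure.pi fun _ : Fin (m + 1) => complexGaussian)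
        {h | u < channelGain h ∧ ‖h 0‖ ^ 2 < t} := by
  set E := EuclideanSpace ℂ (Fin (m + 1))
  -- An orthonormal basis whose vector of index 0 is `v`: its coordinate map is an isometry sending
  -- `⟨v, x⟩` to the coordinate 0.
  obtain ⟨b, hb⟩ := Orthonormal.exists_orthonormalBasis_extension_of_card_eq (𝕜 := ℂ) (E := E)
    (ι := Fin (m + 1)) (by simp [E]) (v := fun _ => WithLp.toLp 2 v) (s := {0}) (by
      rw [orthonormal_iff_ite]
      rintro ⟨i, rfl⟩ ⟨j, rfl⟩
      simp only [Set.domRestrict_apply, if_true]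
      rw [inner_self_eq_norm_sq_to_K]
      have h1 : ((‖(WithLp.toLp 2 v : E)‖ ^ 2 : ℝ) : ℂ) = 1 := by
        rw [← channelGain_eq_norm_sq, hv]; simp
      simpa using h1)
  have hb0 : b 0 = WithLp.toLp 2 v := hb 0 rfl
  let U : E ≃ₗᵢ[ℝ] E :=
    { b.repr with
      toLinearEquiv := b.repr.toLinearEquiv.restrictScalars ℝ }
  have hU : ∀ x, U x = b.repr x := fun _ => rfl
  have hmeas : ∀ f : E → ℂ, Continuous f →
      MeasurableSet {x : E | u < ‖x‖ ^ 2 ∧ ‖f x‖ ^ 2 < t} := fun f hf =>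
    (isOpen_lt (f := fun _ : E => u) (by fun_prop) (g := fun x : E => ‖x‖ ^ 2)
      (by fun_prop)).measurableSet.inter
      (isOpen_lt (f := fun x : E => ‖f x‖ ^ 2) (by fun_prop) (g := fun _ : E => t)
      (by fun_prop)).measurableSet
  have key : ∀ f : E → ℂ, Continuous f →
      (Measure.pi fun _ : Fin (m + 1) => complexGaussian)
        {h | u < channelGain h ∧ ‖f (WithLp.toLp 2 h)‖ ^ 2 < t}
      = stdGaussian E {x : E | u < ‖x‖ ^ 2 ∧ ‖f x‖ ^ 2 < t} := by
    intro f hf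
    rw [← map_toLp_pi_complexGaussian, Measure.map_apply (by fun_prop) (hmeas f hf)]
    simp_rw [channelGain_eq_norm_sq]
    rfl
  have h1 := key (fun x => inner ℂ (WithLp.toLp 2 v : E) x) (by fun_prop)
  have h2 := key (fun x : EuclideanSpace ℂ (Fin (m + 1)) => x 0) (by fun_prop)
  have e : ∀ h : Fin (m + 1) → ℂ, star v ⬝ᵥ h
      = inner ℂ (WithLp.toLp 2 v : E) (WithLp.toLp 2 h) := by
    intro h
    rw [EuclideanSpace.inner_eq_star_dotProduct, dotProduct_comm]
  simp_rw [e]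
  rw [h1]
  refine Eq.trans ?_ h2.symm
  conv_rhs => rw [← stdGaussian_map U, Measure.map_apply (by fun_prop)
      (hmeas (fun x : EuclideanSpace ℂ (Fin (m + 1)) => x 0) (by fun_prop))]
  congr 1
  ext x
  have hx : WithLp.ofLp (p := 2) (V := Fin (m + 1) → ℂ) (U x) 0 = inner ℂ (WithLp.toLp 2 v : E) x := by
    rw [hU, b.repr_apply_apply, hb0]
  simp only [Set.mem_ofPred_eq, Set.preimage_ofPred_eq, LinearIsometryEquiv.norm_map, hx]

/-- Polar coordinates: the angular integral cancels the factor `1 / (2π)`, leaving the Rayleigh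
density. -/
lemma lintegral_norm_complexGaussian (f : ℝ → ℝ≥0∞) (hf : Measurable f) :
    ∫⁻ z, f ‖z‖ ∂complexGaussian
      = ∫⁻ ρ in Set.Ioi (0 : ℝ), ENNReal.ofReal (ρ * Real.exp (-(ρ ^ 2 / 2))) * f ρ := by
  have hnorm : ∀ p : ℝ × ℝ, ‖(⟨p.1, p.2⟩ : ℂ)‖ = √(p.1 ^ 2 + p.2 ^ 2) := fun p => by
    rw [Complex.norm_eq_sqrt_sq_add_sq]
  have hm : Measurable fun p : ℝ × ℝ => f ‖(⟨p.1, p.2⟩ : ℂ)‖ :=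
    hf.comp (measurable_complex_mk.norm)
  rw [complexGaussian, lintegral_map (by fun_prop) measurable_complex_mk,
    gaussianReal_of_var_ne_zero 0 one_ne_zero,
    prod_withDensity (by fun_prop) (by fun_prop),
    lintegral_withDensity_eq_lintegral_mul _ (by fun_prop) hm]
  rw [← Measure.volume_eq_prod, ← lintegral_comp_polarCoord_symm]
  have htarget : polarCoord.target = Set.Ioi (0 : ℝ) ×ˢ Set.Ioo (-Real.pi) Real.pi := rfl
  rw [htarget, Measure.volume_eq_prod, ← Measure.prod_restrict, lintegral_prod _ (by
    apply Measurable.aemeasurable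
    have : Measurable (fun p : ℝ × ℝ => polarCoord.symm p) := by
      simp only [polarCoord_symm_apply]; fun_prop
    have h2 := hm.comp this
    have h3 : Measurable fun p : ℝ × ℝ => gaussianPDF 0 1 p.1 * gaussianPDF 0 1 p.2 := by fun_prop
    exact (measurable_fst.ennreal_ofReal).smul ((h3.comp this).mul h2))]
  refine setLIntegral_congr_fun measurableSet_Ioi fun ρ hρ => ?_
  have hρ' : 0 < ρ := hρ
  have hc : ∀ θ : ℝ, ENNReal.ofReal ρ • ((fun z : ℝ × ℝ => gaussianPDF 0 1 z.1 * gaussianPDF 0 1 z.2)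
      * fun p : ℝ × ℝ => f ‖(⟨p.1, p.2⟩ : ℂ)‖) (polarCoord.symm (ρ, θ))
      = ENNReal.ofReal (ρ * Real.exp (-(ρ ^ 2 / 2)) / (2 * Real.pi)) * f ρ := by
    intro θ
    have hs : (ρ * Real.cos θ) ^ 2 + (ρ * Real.sin θ) ^ 2 = ρ ^ 2 := by
      have := Real.cos_sq_add_sin_sq θ
      linear_combination ρ ^ 2 * this
    simp only [polarCoord_symm_apply, Pi.mul_apply, hnorm, hs, Real.sqrt_sq hρ'.le, smul_eq_mul,
      gaussianPDF, gaussianPDFReal]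
    rw [← mul_assoc, ← ENNReal.ofReal_mul (by positivity), ← ENNReal.ofReal_mul (by positivity)]
    congr 2
    have e1 : Real.exp (-(ρ ^ 2 / 2)) = Real.exp (-(ρ * Real.cos θ) ^ 2 / 2)
        * Real.exp (-(ρ * Real.sin θ) ^ 2 / 2) := by
      rw [← Real.exp_add, ← hs]; congr 1; ring
    have e2 : (√(2 * Real.pi)) ^ 2 = 2 * Real.pi := Real.sq_sqrt (by positivity)
    have e3 : 0 < √(2 * Real.pi) := by positivity
    rw [e1]
    simp only [NNReal.coe_one, mul_one, sub_zero]
    field_simp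
    rw [e2]
  simp_rw [hc]
  rw [setLIntegral_const, Real.volume_Ioo, mul_right_comm, ← ENNReal.ofReal_mul (by positivity)]
  congr 2
  field_simp
  ring

/-! ### Chi-square tails and the small-coordinate estimate. -/

/-- The truncated exponential series `∑_{i<m} (u/2)^i / i!`. -/
noncomputable def truncExp (m : ℕ) (u : ℝ) : ℝ :=
  ∑ i ∈ Finset.range m, (u / 2) ^ i / (i.factorial : ℝ)

lemma continuous_truncExp (m : ℕ) : Continuous (truncExp m) := by
  unfold truncExp; fun_prop

lemma truncExp_succ_zero (m : ℕ) : truncExp (m + 1) 0 = 1 := by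
  simp [truncExp, Finset.sum_range_succ']

lemma truncExp_nonneg (m : ℕ) {u : ℝ} (hu : 0 ≤ u) : 0 ≤ truncExp m u :=
  Finset.sum_nonneg fun _ _ => by positivity

lemma truncExp_mono (m : ℕ) {u v : ℝ} (hu : 0 ≤ u) (huv : u ≤ v) : truncExp m u ≤ truncExp m v :=
  Finset.sum_le_sum fun _ _ => by gcongr

lemma hasDerivAt_truncExp_succ (m : ℕ) (u : ℝ) :
    HasDerivAt (truncExp (m + 1)) (truncExp m u / 2) u := by
  induction m with
  | zero =>
    have : truncExp (0 + 1) = fun _ => 1 := by ext; simp [truncExp]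
    rw [this]; simpa [truncExp] using hasDerivAt_const u (1 : ℝ)
  | succ m ih =>
    have h1 : truncExp (m + 1 + 1)
        = fun u => truncExp (m + 1) u + (u / 2) ^ (m + 1) / ((m + 1).factorial : ℝ) := by
      ext u; simp [truncExp, Finset.sum_range_succ]
    have h2 : truncExp (m + 1) u = truncExp m u + (u / 2) ^ m / (m.factorial : ℝ) := by
      simp [truncExp, Finset.sum_range_succ]
    rw [h1, h2]
    have h3 : HasDerivAt (fun u : ℝ => (u / 2) ^ (m + 1) / ((m + 1).factorial : ℝ))
        ((m + 1 : ℕ) * (u / 2) ^ m * (1 / 2) / ((m + 1).factorial : ℝ)) u :=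
      ((((hasDerivAt_id u).div_const 2).pow (m + 1)).div_const ((m + 1).factorial : ℝ))
    refine (ih.add h3).congr_deriv ?_
    rw [Nat.factorial_succ]
    push_cast
    field_simp

/-- With `x = u / 2`, `x · x^i / i! = (i + 1) x^(i+1) / (i + 1)!` and `i + 1 ≤ m`. This is the
source of the factor `m` in the small-coordinate estimate. -/
lemma mul_truncExp_le (m : ℕ) {u : ℝ} (hu : 0 ≤ u) :
    u / 2 * truncExp m u ≤ m * truncExp (m + 1) u := by
  have h1 : u / 2 * truncExp m u
      = ∑ i ∈ Finset.range m, ((i : ℝ) + 1) * ((u / 2) ^ (i + 1) / ((i + 1).factorial : ℝ)) := by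
    rw [truncExp, Finset.mul_sum]
    refine Finset.sum_congr rfl fun i _ => ?_
    rw [Nat.factorial_succ]; push_cast; field_simp; ring
  have h2 : truncExp (m + 1) u
      = ∑ i ∈ Finset.range m, ((u / 2) ^ (i + 1) / ((i + 1).factorial : ℝ)) + 1 := by
    rw [truncExp, Finset.sum_range_succ']; simp
  rw [h1, h2, mul_add, Finset.mul_sum, mul_one]
  refine le_add_of_le_of_nonneg (Finset.sum_le_sum fun i hi => ?_) (by positivity)
  have : (i : ℝ) + 1 ≤ m := by exact_mod_cast Finset.mem_range.1 hi
  gcongr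

/-- Probability that the gain of `m` independent complex Gaussian coefficients exceeds `u`. -/
noncomputable def gainTail (m : ℕ) (u : ℝ) : ℝ≥0∞ :=
  (Measure.pi fun _ : Fin m => complexGaussian) {h | u < channelGain h}

lemma gainTail_of_neg (m : ℕ) {u : ℝ} (hu : u < 0) : gainTail m u = 1 := by
  have : {h : Fin m → ℂ | u < channelGain h} = Set.univ :=
    Set.eq_univ_of_forall fun h => hu.trans_le (channelGain_nonneg h)
  rw [gainTail, this, measure_univ]

lemma measurableSet_gain (m : ℕ) (u : ℝ) : MeasurableSet {h : Fin m → ℂ | u < channelGain h} :=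
  measurableSet_lt measurable_const measurable_channelGain

lemma measurable_gainTail (m : ℕ) : Measurable (gainTail m) := by
  have : Antitone (gainTail m) := fun a b hab => measure_mono fun h hh => lt_of_le_of_lt hab hh
  exact this.measurable

/-- Fubini: once the first coordinate is `z`, the other `m` must supply the remaining gain `u -
‖z‖²`. -/
lemma gain_first_coord (m : ℕ) (u : ℝ) (s : Set ℂ) (hs : MeasurableSet s) :
    (Measure.pi fun _ : Fin (m + 1) => complexGaussian) {h | u < channelGain h ∧ h 0 ∈ s}
      = ∫⁻ z in s, gainTail m (u - ‖z‖ ^ 2) ∂complexGaussian := by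
  have hmp := measurePreserving_piFinSuccAbove (fun _ : Fin (m + 1) => complexGaussian) 0
  have hT : MeasurableSet {p : ℂ × (Fin m → ℂ) | u < ‖p.1‖ ^ 2 + channelGain p.2 ∧ p.1 ∈ s} :=
    (measurableSet_lt measurable_const
      ((measurable_fst.norm.pow_const 2).add (measurable_channelGain.comp measurable_snd))).inter
      (measurable_fst hs)
  have hpre : {h : Fin (m + 1) → ℂ | u < channelGain h ∧ h 0 ∈ s}
      = (MeasurableEquiv.piFinSuccAbove (fun _ : Fin (m + 1) => ℂ) 0) ⁻¹'
        {p : ℂ × (Fin m → ℂ) | u < ‖p.1‖ ^ 2 + channelGain p.2 ∧ p.1 ∈ s} := by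
    ext h
    simp only [channelGain, Fin.sum_univ_succ, Set.mem_ofPred_eq, Set.mem_preimage,
      MeasurableEquiv.piFinSuccAbove_apply, Fin.insertNthEquiv_symm_apply, Fin.removeNth,
      Fin.succAbove_zero]
  rw [hpre, hmp.measure_preimage hT.nullMeasurableSet, Measure.prod_apply hT,
    ← lintegral_indicator hs]
  refine lintegral_congr fun z => ?_
  by_cases hz : z ∈ s
  · rw [Set.indicator_of_mem hz, gainTail]
    congr 1
    ext h
    simp [hz, sub_lt_iff_lt_add']
  · rw [Set.indicator_of_notMem hz]
    convert measure_empty (μ := Measure.pi fun _ : Fin m => complexGaussian)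
    ext h
    simp [hz]

lemma gainTail_succ (m : ℕ) (u : ℝ) :
    gainTail (m + 1) u = ∫⁻ z, gainTail m (u - ‖z‖ ^ 2) ∂complexGaussian := by
  have := gain_first_coord m u Set.univ MeasurableSet.univ
  simpa [gainTail] using this

/-- Radial integral of a tail function of the given form over an annulus inside the disc. -/
lemma setLIntegral_radial_truncExp (m : ℕ) {u a : ℝ} (ha : 0 ≤ a) (hau : a ^ 2 ≤ u) :
    ∫⁻ ρ in Set.Ioc (0 : ℝ) a, ENNReal.ofReal (ρ * Real.exp (-(ρ ^ 2 / 2)))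
        * ENNReal.ofReal (Real.exp (-((u - ρ ^ 2) / 2)) * truncExp m (u - ρ ^ 2))
      = ENNReal.ofReal (Real.exp (-(u / 2)) * (truncExp (m + 1) u - truncExp (m + 1) (u - a ^ 2))) := by
  have hcont : Continuous fun ρ : ℝ => Real.exp (-(u / 2)) * (ρ * truncExp m (u - ρ ^ 2)) := by
    have := continuous_truncExp m
    fun_prop
  -- The exponentials multiply to the constant `e^{-u/2}`, and `ρ * truncExp m (u - ρ²)` is the
  -- derivative of `-truncExp (m + 1) (u - ρ²)`.
  have h1 : ∀ ρ ∈ Set.Ioc (0 : ℝ) a, ENNReal.ofReal (ρ * Real.exp (-(ρ ^ 2 / 2)))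
        * ENNReal.ofReal (Real.exp (-((u - ρ ^ 2) / 2)) * truncExp m (u - ρ ^ 2))
      = ENNReal.ofReal (Real.exp (-(u / 2)) * (ρ * truncExp m (u - ρ ^ 2))) := by
    intro ρ hρ
    have := hρ.1
    rw [← ENNReal.ofReal_mul (by positivity)]
    congr 1
    have : Real.exp (-(u / 2)) = Real.exp (-(ρ ^ 2 / 2)) * Real.exp (-((u - ρ ^ 2) / 2)) := by
      rw [← Real.exp_add]; congr 1; ring
    rw [this]; ring
  rw [setLIntegral_congr_fun measurableSet_Ioc h1, ← ofReal_integral_eq_lintegral_ofReal,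
    ← intervalIntegral.integral_of_le ha, intervalIntegral.integral_const_mul,
    intervalIntegral.integral_eq_sub_of_hasDerivAt
      (f := fun ρ => - truncExp (m + 1) (u - ρ ^ 2))]
  · congr 1; simp; ring
  · intro ρ _
    have h3 : HasDerivAt (fun x : ℝ => u - x ^ 2) (-(2 * ρ)) ρ := by
      simpa using (hasDerivAt_pow 2 ρ).const_sub u
    have h4 := ((hasDerivAt_truncExp_succ m (u - ρ ^ 2)).comp ρ h3).neg
    exact h4.congr_deriv (by ring)
  · have := continuous_truncExp m
    exact Continuous.intervalIntegrable (by fun_prop) _ _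
  · exact (hcont.integrableOn_Icc (a := 0) (b := a)).mono_set Set.Ioc_subset_Icc_self
  · refine (ae_restrict_iff' measurableSet_Ioc).2 (ae_of_all _ fun ρ hρ => ?_)
    have h3 : ρ ^ 2 ≤ a ^ 2 := by have := hρ.1; have := hρ.2; gcongr
    have := hρ.1
    have := truncExp_nonneg m (u := u - ρ ^ 2) (by linarith)
    simp only [Pi.zero_apply]; positivity

/-- Induction on the number of coordinates, integrating out one radius each time; for `m = 0` both
sides vanish. -/
lemma gainTail_eq (m : ℕ) {u : ℝ} (hu : 0 ≤ u) :
    gainTail m u = ENNReal.ofReal (Real.exp (-(u / 2)) * truncExp m u) := by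
  induction m generalizing u with
  | zero =>
    have : {h : Fin 0 → ℂ | u < channelGain h} = ∅ := by
      ext h; simp [channelGain, hu]
    rw [gainTail, this]; simp [truncExp]
  | succ m ih =>
    rw [gainTail_succ, lintegral_norm_complexGaussian (fun ρ => gainTail m (u - ρ ^ 2))
      ((measurable_gainTail m).comp (by fun_prop)),
      ← Set.Ioc_union_Ioi_eq_Ioi (Real.sqrt_nonneg u),
      lintegral_union measurableSet_Ioi (Set.Ioc_disjoint_Ioi le_rfl)]
    -- Up to radius `√u` the induction hypothesis applies; beyond it the first coordinate alone
    -- exceeds the threshold and the remaining tail is 1.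
    have h1 : ∀ ρ ∈ Set.Ioc (0 : ℝ) √u, ENNReal.ofReal (ρ * Real.exp (-(ρ ^ 2 / 2)))
        * gainTail m (u - ρ ^ 2) = ENNReal.ofReal (ρ * Real.exp (-(ρ ^ 2 / 2)))
        * ENNReal.ofReal (Real.exp (-((u - ρ ^ 2) / 2)) * truncExp m (u - ρ ^ 2)) := by
      intro ρ hρ
      have h3 : ρ ^ 2 ≤ u := by
        have := hρ.1; have := hρ.2
        calc ρ ^ 2 ≤ √u ^ 2 := by gcongr
          _ = u := Real.sq_sqrt hu
      rw [ih (by linarith)]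
    have h2 : ∀ ρ ∈ Set.Ioi √u, ENNReal.ofReal (ρ * Real.exp (-(ρ ^ 2 / 2)))
        * gainTail m (u - ρ ^ 2) = ENNReal.ofReal (ρ * Real.exp (-(ρ ^ 2 / 2))) := by
      intro ρ hρ
      have h3 : u < ρ ^ 2 := Real.lt_sq_of_sqrt_lt hρ
      rw [gainTail_of_neg m (by linarith), mul_one]
    rw [setLIntegral_congr_fun measurableSet_Ioc h1, setLIntegral_congr_fun measurableSet_Ioi h2,
      setLIntegral_radial_truncExp m (Real.sqrt_nonneg u) (Real.sq_sqrt hu).le, Real.sq_sqrt hu,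
      sub_self, truncExp_succ_zero]
    have hderiv : ∀ x ∈ Set.Ici √u, HasDerivAt (fun ρ : ℝ => -Real.exp (-(ρ ^ 2 / 2)))
        (x * Real.exp (-(x ^ 2 / 2))) x := by
      intro x _
      have h3 : HasDerivAt (fun y : ℝ => -(y ^ 2 / 2)) (-(2 * x / 2)) x := by
        exact ((hasDerivAt_pow 2 x).div_const 2).neg.congr_deriv (by simp)
      exact h3.exp.neg.congr_deriv (by ring)
    have hlim : Tendsto (fun ρ : ℝ => -Real.exp (-(ρ ^ 2 / 2))) atTop (nhds 0) := by
      rw [← neg_zero]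
      refine (Real.tendsto_exp_atBot.comp (tendsto_neg_atTop_atBot.comp ?_)).neg
      exact (tendsto_pow_atTop two_ne_zero).atTop_div_const two_pos
    have hpos : ∀ x ∈ Set.Ioi √u, 0 ≤ x * Real.exp (-(x ^ 2 / 2)) := fun x hx =>
      mul_nonneg ((Real.sqrt_nonneg u).trans hx.le) (Real.exp_pos _).le
    rw [← ofReal_integral_eq_lintegral_ofReal
      (integrableOn_Ioi_deriv_of_nonneg' hderiv hpos hlim)
      ((ae_restrict_iff' measurableSet_Ioi).2 (ae_of_all _ hpos)),
      integral_Ioi_of_hasDerivAt_of_nonneg' hderiv hpos hlim, Real.sq_sqrt hu,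
      ← ENNReal.ofReal_add]
    · congr 1; ring
    · have h5 := truncExp_mono (m + 1) le_rfl hu
      rw [truncExp_succ_zero] at h5
      exact mul_nonneg (Real.exp_pos _).le (by linarith)
    · simp [(Real.exp_pos _).le]

/-- Given that the gain exceeds `u`, the first coordinate is rarely small. -/
lemma pi_complexGaussian_first_coord_small (m : ℕ) {u δ : ℝ} (hu : 0 ≤ u) (hδ : 0 ≤ δ)
    (hδ1 : δ ≤ 1) :
    (Measure.pi fun _ : Fin (m + 1) => complexGaussian)
        {h | u < channelGain h ∧ ‖h 0‖ ^ 2 < δ * u}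
      ≤ ENNReal.ofReal (m * δ) * gainTail (m + 1) u := by
  have hms : MeasurableSet {z : ℂ | ‖z‖ ^ 2 < δ * u} :=
    measurableSet_lt (by fun_prop) measurable_const
  have h0 := gain_first_coord m u {z : ℂ | ‖z‖ ^ 2 < δ * u} hms
  simp only [Set.mem_ofPred_eq] at h0
  rw [h0, ← lintegral_indicator hms]
  have e : ∀ z : ℂ, Set.indicator {z : ℂ | ‖z‖ ^ 2 < δ * u} (fun z => gainTail m (u - ‖z‖ ^ 2)) z
      = Set.indicator {ρ : ℝ | ρ ^ 2 < δ * u} (fun ρ => gainTail m (u - ρ ^ 2)) ‖z‖ :=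
    fun z => rfl
  have hms' : MeasurableSet {ρ : ℝ | ρ ^ 2 < δ * u} :=
    measurableSet_lt (by fun_prop) measurable_const
  simp_rw [e]
  have hδu : 0 ≤ δ * u := mul_nonneg hδ hu
  have hδu' : δ * u ≤ u := mul_le_of_le_one_left hu hδ1
  have hmf : Measurable fun ρ : ℝ => gainTail m (u - ρ ^ 2) :=
    (measurable_gainTail m).comp (by fun_prop)
  rw [lintegral_norm_complexGaussian _ (hmf.indicator hms')]
  calc _ ≤ ∫⁻ ρ in Set.Ioc (0 : ℝ) √(δ * u), ENNReal.ofReal (ρ * Real.exp (-(ρ ^ 2 / 2)))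
        * ENNReal.ofReal (Real.exp (-((u - ρ ^ 2) / 2)) * truncExp m (u - ρ ^ 2)) := by
        rw [← lintegral_indicator measurableSet_Ioi, ← lintegral_indicator measurableSet_Ioc]
        refine lintegral_mono fun ρ => ?_
        by_cases h1 : 0 < ρ
        · by_cases h2 : ρ ^ 2 < δ * u
          · have h3 : ρ ∈ Set.Ioc (0 : ℝ) √(δ * u) := ⟨h1, Real.le_sqrt_of_sq_le h2.le⟩
            rw [Set.indicator_of_mem (show ρ ∈ Set.Ioi (0 : ℝ) from h1), Set.indicator_of_mem h3,
              Set.indicator_of_mem (show ρ ∈ {ρ : ℝ | ρ ^ 2 < δ * u} from h2),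
              gainTail_eq m (by linarith)]
          · rw [Set.indicator_of_mem (show ρ ∈ Set.Ioi (0 : ℝ) from h1),
              Set.indicator_of_notMem (show ρ ∉ {ρ : ℝ | ρ ^ 2 < δ * u} from h2), mul_zero]
            exact zero_le
        · rw [Set.indicator_of_notMem (show ρ ∉ Set.Ioi (0 : ℝ) from h1)]
          exact zero_le
    _ = ENNReal.ofReal (Real.exp (-(u / 2)) * (truncExp (m + 1) u
          - truncExp (m + 1) (u - δ * u))) := by
        rw [setLIntegral_radial_truncExp m (Real.sqrt_nonneg _)
          (by rw [Real.sq_sqrt hδu]; exact hδu'), Real.sq_sqrt hδu]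
    _ ≤ _ := by
        rw [gainTail_eq _ hu, ← ENNReal.ofReal_mul (by positivity)]
        apply ENNReal.ofReal_le_ofReal
        -- Mean value inequality: on `[0, u]` the derivative `truncExp m / 2` is largest at `u`.
        have h1 : truncExp (m + 1) u - truncExp (m + 1) (u - δ * u)
            ≤ truncExp m u / 2 * (u - (u - δ * u)) := by
          refine (convex_Icc (0 : ℝ) u).image_sub_le_mul_sub_of_deriv_le
            (continuous_truncExp _).continuousOn
            (fun x _ => (hasDerivAt_truncExp_succ m x).differentiableAt.differentiableWithinAt)
            (fun x hx => ?_) _ ⟨by linarith, by linarith⟩ _ ⟨hu, le_rfl⟩ (by linarith)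
          rw [interior_Icc] at hx
          rw [(hasDerivAt_truncExp_succ m x).deriv]
          have := truncExp_mono m hx.1.le hx.2.le
          linarith
        have h2 := mul_truncExp_le m hu
        have h3 : truncExp m u / 2 * (u - (u - δ * u)) ≤ δ * (m * truncExp (m + 1) u) := by
          nlinarith
        have := Real.exp_pos (-(u / 2))
        calc _ ≤ Real.exp (-(u / 2)) * (δ * (m * truncExp (m + 1) u)) := by
              gcongr; exact h1.trans h3
          _ = _ := by ring

/-! ### The MMSE quadratic form and its projection bound. -/

open Matrix in
lemma star_dotProduct_self_complex {ι : Type*} [Fintype ι] (y : ι → ℂ) :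
    star y ⬝ᵥ y = ((∑ i, ‖y i‖ ^ 2 : ℝ) : ℂ) := by
  simp only [dotProduct, Pi.star_apply, Complex.ofReal_sum]
  refine Finset.sum_congr rfl fun i _ => ?_
  rw [Complex.star_def, Complex.conj_mul']
  simp

open Matrix ComplexOrder in
lemma posDef_mul_conjTranspose_add_one {ι κ : Type*} [Fintype ι] [Fintype κ] [DecidableEq ι]
    (G : Matrix ι κ ℂ) : (G * Gᴴ + 1).PosDef :=
  PosDef.posSemidef_add (posSemidef_self_mul_conjTranspose G) PosDef.one

open Matrix ComplexOrder in
lemma isUnit_det_mul_conjTranspose_add_one {ι κ : Type*} [Fintype ι] [Fintype κ] [DecidableEq ι]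
    (G : Matrix ι κ ℂ) : IsUnit (G * Gᴴ + 1).det :=
  (isUnit_iff_isUnit_det _).1 (posDef_mul_conjTranspose_add_one G).isUnit

open Matrix in
/-- Resolvent bounds for the quadratic form of `(G Gᴴ + 1)⁻¹`. -/
lemma quadForm_inv_bounds {r : ℕ} {κ : Type*} [Fintype κ] (G : Matrix (Fin r) κ ℂ)
    (h : Fin r → ℂ) :
    (star h ⬝ᵥ (G * Gᴴ + 1)⁻¹ *ᵥ h).re ≤ channelGain h ∧
    0 ≤ (star h ⬝ᵥ (G * Gᴴ + 1)⁻¹ *ᵥ h).re ∧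
    ∀ v : Fin r → ℂ, channelGain v = 1 → Gᴴ *ᵥ v = 0 →
      ‖star v ⬝ᵥ h‖ ^ 2 ≤ (star h ⬝ᵥ (G * Gᴴ + 1)⁻¹ *ᵥ h).re := by
  -- With `w = R h` and `y = Gᴴ w` one has `h = w + G y`, so the form equals `‖w‖² + ‖y‖²` while
  -- `‖h‖² = ‖w‖² + 2‖y‖² + ‖G y‖²`.
  obtain ⟨w, hw⟩ : ∃ w, w = (G * Gᴴ + 1)⁻¹ *ᵥ h := ⟨_, rfl⟩
  obtain ⟨y, hy⟩ : ∃ y, y = Gᴴ *ᵥ w := ⟨_, rfl⟩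
  have hh : h = w + G *ᵥ y := by
    have : (G * Gᴴ + 1) *ᵥ w = h := by
      rw [hw, mulVec_mulVec, mul_nonsing_inv _ (isUnit_det_mul_conjTranspose_add_one G), one_mulVec]
    rw [← this, add_mulVec, one_mulVec, hy, mulVec_mulVec, add_comm]
  rw [← hw]
  have hGy : star (G *ᵥ y) ⬝ᵥ w = star y ⬝ᵥ y := by
    rw [star_mulVec, ← dotProduct_mulVec, ← hy]
  have hGy' : star w ⬝ᵥ (G *ᵥ y) = star y ⬝ᵥ y := by
    rw [dotProduct_mulVec, hy, star_mulVec, conjTranspose_conjTranspose]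
  have hq : (star h ⬝ᵥ w).re = channelGain w + ∑ s, ‖y s‖ ^ 2 := by
    conv_lhs => rw [hh]
    rw [star_add, add_dotProduct, hGy, star_dotProduct_self_complex, star_dotProduct_self_complex,
      ← Complex.ofReal_add, Complex.ofReal_re]
    rfl
  have hhh : channelGain h = channelGain w + 2 * ∑ s, ‖y s‖ ^ 2 + channelGain (G *ᵥ y) := by
    have e : ((channelGain h : ℝ) : ℂ)
        = ((channelGain w + 2 * ∑ s, ‖y s‖ ^ 2 + channelGain (G *ᵥ y) : ℝ) : ℂ) := by
      have h1 : ((channelGain h : ℝ) : ℂ) = star h ⬝ᵥ h := (star_dotProduct_self_complex h).symm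
      rw [h1]
      conv_lhs => rw [hh]
      rw [star_add, add_dotProduct, dotProduct_add, dotProduct_add, hGy, hGy',
        star_dotProduct_self_complex, star_dotProduct_self_complex, star_dotProduct_self_complex]
      unfold channelGain
      push_cast
      ring
    exact_mod_cast e
  have hy0 : 0 ≤ ∑ s, ‖y s‖ ^ 2 := Finset.sum_nonneg fun _ _ => by positivity
  have hw0 := channelGain_nonneg w
  have hG0 := channelGain_nonneg (G *ᵥ y)
  refine ⟨by rw [hq, hhh]; linarith, by rw [hq]; linarith, fun v hv hGv => ?_⟩
  -- Since `v` is orthogonal to the range of `G`, it sees only `w`; Cauchy–Schwarz then bounds its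
  -- square by `‖w‖²`.
  have h1 : star v ⬝ᵥ h = star v ⬝ᵥ w := by
    have h2 : star v ⬝ᵥ (G *ᵥ y) = 0 := by
      have h3 : star v ᵥ* G = 0 := by
        have := congrArg star hGv
        rwa [star_mulVec, conjTranspose_conjTranspose, star_zero] at this
      rw [dotProduct_mulVec, h3, zero_dotProduct]
    rw [hh, dotProduct_add, h2, add_zero]
  have h2 : ‖star v ⬝ᵥ w‖ ^ 2 ≤ channelGain v * channelGain w := by
    have h3 := norm_inner_le_norm (𝕜 := ℂ) (WithLp.toLp 2 v : EuclideanSpace ℂ (Fin r))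
      (WithLp.toLp 2 w)
    rw [EuclideanSpace.inner_eq_star_dotProduct, dotProduct_comm] at h3
    rw [channelGain_eq_norm_sq, channelGain_eq_norm_sq, ← mul_pow]
    exact pow_le_pow_left₀ (norm_nonneg _) h3 2
  rw [h1, hq]
  rw [hv, one_mul] at h2
  linarith

section SINR
variable {K r : ℕ}

lemma mmseSINR_le (H : Fin K → Fin r → ℂ) (S : Finset (Fin K)) (i : Fin K) :
    mmseSINR H S i ≤ channelGain (H i) :=
  (quadForm_inv_bounds (interferenceMatrix H S i) (H i)).1

lemma mmseSINR_nonneg (H : Fin K → Fin r → ℂ) (S : Finset (Fin K)) (i : Fin K) :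
    0 ≤ mmseSINR H S i :=
  (quadForm_inv_bounds (interferenceMatrix H S i) (H i)).2.1

open Matrix in
/-- With at most `r` streams, some unit vector is orthogonal to all interfering channels. -/
lemma exists_unit_orthogonal_interference (H : Fin K → Fin r → ℂ) (S : Finset (Fin K)) {i : Fin K}
    (hi : i ∈ S) (hS : S.card ≤ r) :
    ∃ v : Fin r → ℂ, channelGain v = 1 ∧ (interferenceMatrix H S i)ᴴ *ᵥ v = 0 := by
  have hcard : Module.finrank ℂ ({s // s ∈ S.erase i} → ℂ) < Module.finrank ℂ (Fin r → ℂ) := by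
    rw [Module.finrank_fintype_fun_eq_card, Module.finrank_fintype_fun_eq_card, Fintype.card_coe,
      Fintype.card_fin, Finset.card_erase_of_mem hi]
    have := Finset.card_pos.2 ⟨i, hi⟩
    omega
  have hker := LinearMap.ker_ne_bot_of_finrank_lt (f := (interferenceMatrix H S i)ᴴ.mulVecLin) hcard
  obtain ⟨v, hv, hv0⟩ := Submodule.exists_mem_ne_zero_of_ne_bot hker
  have hv1 : (interferenceMatrix H S i)ᴴ *ᵥ v = 0 := by simpa using hv
  have hn : ‖(WithLp.toLp 2 v : EuclideanSpace ℂ (Fin r))‖ ≠ 0 := by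
    rw [norm_ne_zero_iff]
    intro h
    exact hv0 (by simpa using h)
  set c : ℂ := ((‖(WithLp.toLp 2 v : EuclideanSpace ℂ (Fin r))‖⁻¹ : ℝ) : ℂ)
  refine ⟨c • v, ?_, by rw [mulVec_smul, hv1, smul_zero]⟩
  rw [channelGain_eq_norm_sq, WithLp.toLp_smul, norm_smul]
  simp only [c, Complex.norm_real, norm_inv, norm_norm]
  rw [inv_mul_cancel₀ hn, one_pow]

/-- The interference-plus-noise matrix does not involve the channel of the stream itself. -/
lemma interferenceMatrix_update (H : Fin K → Fin r → ℂ) (S : Finset (Fin K)) (i : Fin K)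
    (h : Fin r → ℂ) :
    interferenceMatrix (Function.update H i h) S i = interferenceMatrix H S i := by
  ext n s
  have : s.1 ≠ i := Finset.ne_of_mem_erase s.2
  simp [interferenceMatrix, Function.update_of_ne this]

open Matrix in
-- The inverse is continuous everywhere because `G Gᴴ + 1` is never singular.
lemma continuous_mmseSINR (S : Finset (Fin K)) (i : Fin K) :
    Continuous fun H : Fin K → Fin r → ℂ => mmseSINR H S i := by
  have hG : Continuous fun H : Fin K → Fin r → ℂ => interferenceMatrix H S i :=
    continuous_matrix fun n s => by simp only [interferenceMatrix, Matrix.of_apply]; fun_prop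
  have hA : Continuous fun H : Fin K → Fin r → ℂ =>
      interferenceMatrix H S i * (interferenceMatrix H S i)ᴴ + 1 :=
    (hG.matrix_mul hG.matrix_conjTranspose).add continuous_const
  have hR : Continuous fun H : Fin K → Fin r → ℂ => mmseMatrix H S i := by
    unfold mmseMatrix
    simp_rw [Matrix.inv_def, Ring.inverse_eq_inv']
    exact (hA.matrix_det.inv₀ fun H =>
      (isUnit_det_mul_conjTranspose_add_one (interferenceMatrix H S i)).ne_zero).smul
      hA.matrix_adjugate
  unfold mmseSINR
  have hHi : Continuous fun H : Fin K → Fin r → ℂ => H i := continuous_apply i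
  exact Complex.continuous_re.comp (hHi.star.dotProduct (hR.matrix_mulVec hHi))

/-- Given the other channels, stream `i` rarely has small SINR compared to the threshold. -/
lemma pi_complexGaussian_small_SINR_le (H : Fin K → Fin r → ℂ) (S : Finset (Fin K)) {i : Fin K} (hi : i ∈ S)
    (hS : S.card ≤ r) {u δ : ℝ} (hu : 0 ≤ u) (hδ : 0 ≤ δ) (hδ1 : δ ≤ 1) :
    (Measure.pi fun _ : Fin r => complexGaussian)
        {h | u < channelGain h ∧ mmseSINR (Function.update H i h) S i < δ * u}
      ≤ ENNReal.ofReal (r * δ) * gainTail r u := by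
  obtain ⟨v, hv, hGv⟩ := exists_unit_orthogonal_interference H S hi hS
  obtain _ | m := r
  · have : S.card = 0 := by omega
    rw [Finset.card_eq_zero] at this
    simp [this] at hi
  calc _ ≤ (Measure.pi fun _ : Fin (m + 1) => complexGaussian)
        {h | u < channelGain h ∧ ‖star v ⬝ᵥ h‖ ^ 2 < δ * u} := by
        refine measure_mono fun h hh => ⟨hh.1, lt_of_le_of_lt ?_ hh.2⟩
        have := (quadForm_inv_bounds (interferenceMatrix H S i) h).2.2 v hv hGv
        simpa [mmseSINR, mmseMatrix, interferenceMatrix_update] using this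
    _ = _ := pi_complexGaussian_rotate v hv u (δ * u)
    _ ≤ _ := pi_complexGaussian_first_coord_small m hu hδ hδ1
    _ ≤ _ := by
        gcongr
        norm_num

end SINR

/-! ### The random transmitting set and the lower bound on expected capacity. -/

/-- The probability that one user exceeds the threshold. -/
noncomputable def exceedProb (r : ℕ) (u : ℝ) : ℝ := (gainTail r u).toReal

lemma exceedProb_nonneg (r : ℕ) (u : ℝ) : 0 ≤ exceedProb r u := ENNReal.toReal_nonneg

lemma exceedProb_le_one (r : ℕ) (u : ℝ) : exceedProb r u ≤ 1 :=
  measureReal_le_one (μ := Measure.pi fun _ : Fin r => complexGaussian)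

lemma exceedProb_eq (r : ℕ) {u : ℝ} (hu : 0 ≤ u) :
    exceedProb r u = Real.exp (-(u / 2)) * truncExp r u := by
  rw [exceedProb, gainTail_eq r hu, ENNReal.toReal_ofReal]
  exact mul_nonneg (Real.exp_pos _).le (truncExp_nonneg r hu)

section Transmitting
variable {K r : ℕ}

lemma mem_transmitting {u : ℝ} {H : Fin K → Fin r → ℂ} {s : Fin K} :
    s ∈ transmitting u H ↔ u < channelGain (H s) := by
  simp [transmitting]

/-- The event is a product over users, so independence yields its probability and hence the binomial
weights. -/
lemma setOf_transmitting_eq (u : ℝ) (S : Finset (Fin K)) :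
    {H : Fin K → Fin r → ℂ | transmitting u H = S}
      = Set.univ.pi fun s => if s ∈ S then {h | u < channelGain h} else {h | u < channelGain h}ᶜ := by
  ext H
  simp only [Set.mem_ofPred_eq, Finset.ext_iff, mem_transmitting, Set.mem_univ_pi]
  refine forall_congr' fun s => ?_
  by_cases hs : s ∈ S <;> simp [hs]

lemma measurableSet_transmitting_eq (u : ℝ) (S : Finset (Fin K)) :
    MeasurableSet {H : Fin K → Fin r → ℂ | transmitting u H = S} := by
  rw [setOf_transmitting_eq]
  refine MeasurableSet.univ_pi fun s => ?_
  split_ifs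
  · exact measurableSet_gain r u
  · exact (measurableSet_gain r u).compl

lemma measureReal_transmitting_eq (u : ℝ) (S : Finset (Fin K)) :
    (channelLaw K r).real {H | transmitting u H = S}
      = exceedProb r u ^ S.card * (1 - exceedProb r u) ^ (K - S.card) := by
  have h : ∀ s : Fin K, ((Measure.pi fun _ : Fin r => complexGaussian)
      (if s ∈ S then {h | u < channelGain h} else {h | u < channelGain h}ᶜ)).toReal
      = if s ∈ S then exceedProb r u else 1 - exceedProb r u := by
    intro s
    split_ifs
    · rfl
    · exact probReal_compl_eq_one_sub (measurableSet_gain r u)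
  rw [setOf_transmitting_eq, Measure.real, channelLaw, Measure.pi_pi, ENNReal.toReal_prod]
  simp_rw [h]
  rw [Finset.prod_ite, Finset.prod_const, Finset.prod_const, Finset.filter_univ_mem,
    Finset.filter_not, Finset.filter_univ_mem, ← Finset.compl_eq_univ_sdiff, Finset.card_compl,
    Fintype.card_fin]

lemma expectedExceedances_eq (K r : ℕ) (u : ℝ) :
    expectedExceedances K r u = K * exceedProb r u := by
  have h1 : ∀ H : Fin K → Fin r → ℂ, ((transmitting u H).card : ℝ)
      = ∑ s, Set.indicator ((fun H : Fin K → Fin r → ℂ => H s) ⁻¹' {h | u < channelGain h}) 1 H := by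
    intro H
    simp [transmitting, Set.indicator_apply, Finset.sum_boole]
  have h2 : ∀ s : Fin K, MeasurePreserving (fun H : Fin K → Fin r → ℂ => H s) (channelLaw K r)
      (Measure.pi fun _ : Fin r => complexGaussian) := fun s =>
    measurePreserving_eval (fun _ => Measure.pi fun _ : Fin r => complexGaussian) s
  have hm : ∀ s : Fin K, MeasurableSet ((fun H : Fin K → Fin r → ℂ => H s) ⁻¹'
      {h | u < channelGain h}) := fun s => (h2 s).measurable (measurableSet_gain r u)
  rw [expectedExceedances]
  simp_rw [h1]
  have hint : ∀ s : Fin K, Integrable (fun H => Set.indicator ((fun H : Fin K → Fin r → ℂ => H s) ⁻¹'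
      {h | u < channelGain h}) (1 : (Fin K → Fin r → ℂ) → ℝ) H) (channelLaw K r) := fun s =>
    (integrable_const (1 : ℝ)).indicator (hm s)
  rw [integral_finsetSum _ fun s _ => hint s]
  have h3 : ∀ s : Fin K, ∫ H, Set.indicator ((fun H : Fin K → Fin r → ℂ => H s) ⁻¹'
      {h | u < channelGain h}) (1 : (Fin K → Fin r → ℂ) → ℝ) H ∂(channelLaw K r) = exceedProb r u := by
    intro s
    rw [integral_indicator_one (hm s), Measure.real,
      (h2 s).measure_preimage (measurableSet_gain r u).nullMeasurableSet]
    rfl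
  simp_rw [h3]
  rw [Finset.sum_const, Finset.card_univ, Fintype.card_fin, nsmul_eq_mul]

lemma transmitting_update_eq_iff {u : ℝ} {S : Finset (Fin K)} {i : Fin K} (hi : i ∈ S)
    (H : Fin K → Fin r → ℂ) (h : Fin r → ℂ) :
    transmitting u (Function.update H i h) = S ↔
      u < channelGain h ∧ ∀ s, s ≠ i → (u < channelGain (H s) ↔ s ∈ S) := by
  rw [Finset.ext_iff]
  simp only [mem_transmitting]
  constructor
  · intro hs
    refine ⟨by simpa [hi] using hs i, fun s hsi => ?_⟩
    simpa [Function.update_of_ne hsi] using hs s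
  · rintro ⟨h1, h2⟩ s
    by_cases hsi : s = i
    · subst hsi; simp [h1, hi]
    · simpa [Function.update_of_ne hsi] using h2 s hsi

lemma measure_small_SINR_le (S : Finset (Fin K)) {i : Fin K} (hi : i ∈ S)
    (hS : S.card ≤ r) {u δ : ℝ} (hu : 0 ≤ u) (hδ : 0 ≤ δ) (hδ1 : δ ≤ 1) :
    channelLaw K r {H | transmitting u H = S ∧ mmseSINR H S i < δ * u}
      ≤ ENNReal.ofReal (r * δ) * channelLaw K r {H | transmitting u H = S} := by
  have hgood := measurableSet_transmitting_eq (r := r) u S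
  have hbad : MeasurableSet {H : Fin K → Fin r → ℂ | transmitting u H = S ∧
      mmseSINR H S i < δ * u} :=
    hgood.inter (measurableSet_lt (continuous_mmseSINR S i).measurable measurable_const)
  rw [← lintegral_indicator_one hbad, ← lintegral_indicator_one hgood,
    ← lintegral_const_mul _ (measurable_one.indicator hgood)]
  -- It suffices to compare the integrals over the channel of user `i` with all other channels
  -- frozen, which also freezes the interference.
  refine lintegral_le_of_lmarginal_le {i} (measurable_one.indicator hbad)
    ((measurable_one.indicator hgood).const_mul _) fun H => ?_
  rw [lmarginal_singleton, lmarginal_singleton]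
  simp only
  have hup : Measurable fun h : Fin r → ℂ => Function.update H i h := measurable_update H
  have e1 : ∀ h : Fin r → ℂ, Set.indicator {H : Fin K → Fin r → ℂ | transmitting u H = S ∧
      mmseSINR H S i < δ * u} (1 : (Fin K → Fin r → ℂ) → ℝ≥0∞) (Function.update H i h)
      = Set.indicator ((fun h => Function.update H i h) ⁻¹' {H : Fin K → Fin r → ℂ |
        transmitting u H = S ∧ mmseSINR H S i < δ * u}) 1 h := fun h => rfl
  have e2 : ∀ h : Fin r → ℂ, Set.indicator {H : Fin K → Fin r → ℂ | transmitting u H = S}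
      (1 : (Fin K → Fin r → ℂ) → ℝ≥0∞) (Function.update H i h)
      = Set.indicator ((fun h => Function.update H i h) ⁻¹' {H : Fin K → Fin r → ℂ |
        transmitting u H = S}) 1 h := fun h => rfl
  simp_rw [e1, e2]
  rw [lintegral_const_mul _ ((measurable_one (β := Fin r → ℂ) (α := ℝ≥0∞)).indicator (hup hgood)), lintegral_indicator_one (hup hbad), lintegral_indicator_one (hup hgood)]
  -- If the other users do not match `S`, both events are empty in the variable `h`.
  by_cases hrest : ∀ s, s ≠ i → (u < channelGain (H s) ↔ s ∈ S)
  · have := pi_complexGaussian_small_SINR_le H S hi hS hu hδ hδ1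
    simp only [Set.preimage_ofPred_eq, transmitting_update_eq_iff hi, and_iff_left hrest]
    exact this
  · simp only [Set.preimage_ofPred_eq, transmitting_update_eq_iff hi, hrest, and_false, false_and]
    simp

lemma integrable_channelGain_eval (i : Fin K) :
    Integrable (fun H : Fin K → Fin r → ℂ => channelGain (H i)) (channelLaw K r) := by
  have h1 : Integrable (fun z : ℂ => ‖z‖ ^ 2) complexGaussian := by
    rw [complexGaussian, integrable_map_measure (by fun_prop)
      measurable_complex_mk.aemeasurable]
    have hsq : Integrable (fun x : ℝ => x ^ 2) (gaussianReal 0 1) :=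
      (memLp_id_gaussianReal (μ := 0) (v := 1) 2).integrable_sq
    have h2 := (hsq.comp_fst (gaussianReal 0 1)).add (hsq.comp_snd (gaussianReal 0 1))
    refine h2.congr (ae_of_all _ fun p => ?_)
    simp only [Pi.add_apply, Function.comp_apply]
    rw [← Complex.normSq_eq_norm_sq, Complex.normSq_apply]
    ring
  have h2 : Integrable (channelGain (r := r)) (Measure.pi fun _ => complexGaussian) :=
    integrable_finsetSum _ fun n _ =>
      (measurePreserving_eval (fun _ : Fin r => complexGaussian) n).integrable_comp_of_integrable h1
  exact (measurePreserving_eval (fun _ : Fin K => Measure.pi fun _ : Fin r => complexGaussian)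
    i).integrable_comp_of_integrable h2

/-- The contribution of stream `i` to the slot capacity on the event that `S` transmits. -/
noncomputable def streamRate (u : ℝ) (S : Finset (Fin K)) (i : Fin K) (H : Fin K → Fin r → ℂ) : ℝ :=
  Set.indicator {H | transmitting u H = S} (fun H => Real.log (1 + mmseSINR H S i)) H

/-- Domination: `0 ≤ log (1 + SINR) ≤ SINR ≤ ‖hᵢ‖²`, and the gain has finite mean. -/
lemma integrable_streamRate (u : ℝ) (S : Finset (Fin K)) (i : Fin K) :
    Integrable (streamRate (r := r) u S i) (channelLaw K r) := by
  refine Integrable.indicator ?_ (measurableSet_transmitting_eq u S)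
  refine (integrable_channelGain_eval i).mono'
    (Real.measurable_log.comp
      ((continuous_mmseSINR S i).measurable.const_add 1)).aestronglyMeasurable
    (ae_of_all _ fun H => ?_)
  have h0 := mmseSINR_nonneg H S i
  have h1 := mmseSINR_le H S i
  rw [Real.norm_of_nonneg (Real.log_nonneg (by linarith))]
  linarith [Real.log_le_sub_one_of_pos (show 0 < 1 + mmseSINR H S i by linarith)]

lemma slotCapacity_eq_sum (u : ℝ) (H : Fin K → Fin r → ℂ) :
    slotCapacity 1 u H
      = ∑ S : Finset (Fin K), if S.card ≤ r then ∑ i ∈ S, streamRate u S i H else 0 := by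
  rw [Finset.sum_eq_single (transmitting u H)]
  · simp [slotCapacity, streamRate]
  · intro S _ hS
    split_ifs
    · refine Finset.sum_eq_zero fun i _ => ?_
      simp [streamRate, hS.symm]
    · rfl
  · simp

lemma integrable_slotSummand (u : ℝ) (S : Finset (Fin K)) :
    Integrable (fun H : Fin K → Fin r → ℂ =>
      if S.card ≤ r then ∑ i ∈ S, streamRate u S i H else 0) (channelLaw K r) := by
  split_ifs
  · exact integrable_finsetSum _ fun i _ => integrable_streamRate u S i
  · exact integrable_zero _ _ _

lemma integrable_slotCapacity (K r : ℕ) (u : ℝ) :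
    Integrable (fun H : Fin K → Fin r → ℂ => slotCapacity 1 u H) (channelLaw K r) := by
  simp_rw [slotCapacity_eq_sum]
  exact integrable_finsetSum _ fun S _ => integrable_slotSummand u S

lemma integral_streamRate_ge (S : Finset (Fin K)) {i : Fin K} (hi : i ∈ S)
    (hS : S.card ≤ r) {u δ : ℝ} (hu : 0 ≤ u) (hδ : 0 ≤ δ) (hδ1 : δ ≤ 1) :
    (1 - r * δ) * Real.log (1 + δ * u) * (channelLaw K r).real {H | transmitting u H = S}
      ≤ ∫ H, streamRate u S i H ∂(channelLaw K r) := by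
  have hgood := measurableSet_transmitting_eq (r := r) u S
  have hlow : MeasurableSet {H : Fin K → Fin r → ℂ | mmseSINR H S i < δ * u} :=
    measurableSet_lt (continuous_mmseSINR S i).measurable measurable_const
  have hδu : 0 ≤ δ * u := mul_nonneg hδ hu
  have hlog : 0 ≤ Real.log (1 + δ * u) := Real.log_nonneg (by linarith)
  have hbad : (channelLaw K r).real ({H | transmitting u H = S} ∩
      {H | mmseSINR H S i < δ * u}) ≤ r * δ * (channelLaw K r).real {H | transmitting u H = S} := by
    have h := ENNReal.toReal_mono (by finiteness) (measure_small_SINR_le S hi hS hu hδ hδ1)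
    rwa [ENNReal.toReal_mul, ENNReal.toReal_ofReal (by positivity)] at h
  have hdiff := measureReal_inter_add_sdiff (μ := channelLaw K r) (s := {H | transmitting u H = S}) hlow
  have hms : MeasurableSet ({H : Fin K → Fin r → ℂ | transmitting u H = S} \
      {H | mmseSINR H S i < δ * u}) := hgood.diff hlow
  calc _ ≤ (channelLaw K r).real ({H | transmitting u H = S} \
      {H | mmseSINR H S i < δ * u}) * Real.log (1 + δ * u) := by
        nlinarith
    _ = ∫ H, Set.indicator ({H | transmitting u H = S} \
      {H | mmseSINR H S i < δ * u}) (fun _ => Real.log (1 + δ * u)) H ∂(channelLaw K r) := by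
        rw [integral_indicator_const _ hms, smul_eq_mul]
    _ ≤ _ := by
        refine integral_mono ((integrable_const _).indicator hms) (integrable_streamRate u S i)
          fun H => ?_
        have h0 := mmseSINR_nonneg H S i
        by_cases hH : transmitting u H = S
        · by_cases hH' : mmseSINR H S i < δ * u
          · simp only [streamRate, Set.indicator_apply, Set.mem_sdiff, Set.mem_ofPred_eq, hH, hH',
              not_true, and_false, if_false, if_true]
            exact Real.log_nonneg (by linarith)
          · simp only [streamRate, Set.indicator_apply, Set.mem_sdiff, Set.mem_ofPred_eq, hH, hH',
              not_false_eq_true, and_true, if_true]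
            exact Real.log_le_log (by linarith) (by linarith [not_lt.1 hH'])
        · simp [streamRate, hH]

/-- Lower bound on the expected capacity through the binomial law of the number of users. -/
lemma expectedCapacity_ge (hK : r ≤ K) {u δ : ℝ} (hu : 0 ≤ u) (hδ : 0 ≤ δ) (hδ1 : δ ≤ 1)
    (hrδ : r * δ ≤ 1) :
    (1 - r * δ) * Real.log (1 + δ * u) * ∑ j ∈ Finset.Icc 1 r,
      j * ((K.choose j : ℝ) * exceedProb r u ^ j * (1 - exceedProb r u) ^ (K - j))
      ≤ expectedCapacity K r 1 u := by
  set c := (1 - r * δ) * Real.log (1 + δ * u) with hc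
  have hc0 : 0 ≤ c := mul_nonneg (by linarith)
    (Real.log_nonneg (by linarith [mul_nonneg hδ hu]))
  have hp0 := exceedProb_nonneg r u
  have hp1 := exceedProb_le_one r u
  -- Lower bound for the contribution of one set of size `j`; summing over sets grouped by size
  -- produces the binomial coefficients.
  let f : ℕ → ℝ := fun j => if j ≤ r then
    j * (c * (exceedProb r u ^ j * (1 - exceedProb r u) ^ (K - j))) else 0
  have hf0 : ∀ j, 0 ≤ f j := fun j => by
    have : 0 ≤ 1 - exceedProb r u := by linarith
    simp only [f]
    split_ifs <;> positivity
  rw [expectedCapacity]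
  simp_rw [slotCapacity_eq_sum]
  rw [integral_finsetSum _ fun S _ => integrable_slotSummand u S]
  calc _ = ∑ j ∈ Finset.Icc 1 r, K.choose j • f j := by
        rw [Finset.mul_sum]
        refine Finset.sum_congr rfl fun j hj => ?_
        simp only [f, if_pos (Finset.mem_Icc.1 hj).2, nsmul_eq_mul]
        ring
    _ ≤ ∑ j ∈ Finset.range (K + 1), K.choose j • f j := by
        refine Finset.sum_le_sum_of_subset_of_nonneg (fun j hj => ?_)
          fun j _ _ => nsmul_nonneg (hf0 j) _
        rw [Finset.mem_Icc] at hj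
        rw [Finset.mem_range]
        omega
    _ = ∑ S : Finset (Fin K), f S.card := by
        have := Finset.sum_powerset_apply_card f (x := (Finset.univ : Finset (Fin K)))
        rw [Finset.powerset_univ, Finset.card_univ, Fintype.card_fin] at this
        exact this.symm
    _ ≤ _ := by
        refine Finset.sum_le_sum fun S _ => ?_
        simp only [f]
        split_ifs with hS
        · rw [integral_finsetSum _ fun i _ => integrable_streamRate u S i, ← nsmul_eq_mul]
          refine Finset.card_nsmul_le_sum _ _ _ fun i hi => ?_
          rw [← measureReal_transmitting_eq]
          exact integral_streamRate_ge S hi hS hu hδ hδ1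
        · simp

end Transmitting

/-! ### Incomplete Gamma asymptotics and the size of `B_j`. -/

lemma integrableOn_upperGamma (s : ℝ) {x : ℝ} (hx : 0 < x) :
    IntegrableOn (fun t : ℝ => t ^ (s - 1) * Real.exp (-t)) (Set.Ioi x) := by
  refine integrable_of_isBigO_exp_neg (b := 1 / 2) (by norm_num) ?_ ?_
  · intro t ht
    have : t ≠ 0 := (hx.trans_le ht).ne'
    exact ((Real.continuousAt_rpow_const _ _ (Or.inl this)).mul (by fun_prop)).continuousWithinAt
  · have := (Real.Gamma_integrand_isLittleO (s - 1)).isBigO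
    refine this.congr_left fun t => mul_comm _ _

lemma upperGamma_nonneg (s : ℝ) {x : ℝ} (hx : 0 < x) : 0 ≤ upperGamma s x :=
  setIntegral_nonneg measurableSet_Ioi fun t ht => by
    have : 0 < t := hx.trans ht
    positivity

lemma upperGamma_anti (s : ℝ) {x y : ℝ} (hx : 0 < x) (hxy : x ≤ y) :
    upperGamma s y ≤ upperGamma s x := by
  refine setIntegral_mono_set (integrableOn_upperGamma s hx) ?_
    (Set.Ioi_subset_Ioi hxy).eventuallyLE
  refine (ae_restrict_iff' measurableSet_Ioi).2 (ae_of_all _ fun t ht => ?_)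
  have : 0 < t := hx.trans ht
  simp only [Pi.zero_apply]
  positivity

/-- On `t > x` the factor `t^(s - s')` is at most its value at `x`, the exponent being nonpositive.
-/
lemma upperGamma_le_rpow_mul {s s' : ℝ} (h : s ≤ s') {x : ℝ} (hx : 0 < x) :
    upperGamma s x ≤ x ^ (s - s') * upperGamma s' x := by
  rw [upperGamma, upperGamma, ← integral_const_mul]
  refine setIntegral_mono_on (integrableOn_upperGamma s hx)
    ((integrableOn_upperGamma s' hx).const_mul _) measurableSet_Ioi fun t ht => ?_
  have ht0 : 0 < t := hx.trans ht
  have h1 : t ^ (s - 1) = t ^ (s - s') * t ^ (s' - 1) := by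
    rw [← Real.rpow_add ht0]; congr 1; ring
  have h2 : t ^ (s - s') ≤ x ^ (s - s') :=
    Real.rpow_le_rpow_of_nonpos hx (le_of_lt ht) (by linarith)
  rw [h1, mul_assoc]
  gcongr

/-- Integration by parts; as `x > 0` keeps the integral away from the origin, every real `s` is
allowed. -/
lemma upperGamma_rec (s : ℝ) {x : ℝ} (hx : 0 < x) :
    upperGamma s x = x ^ (s - 1) * Real.exp (-x) + (s - 1) * upperGamma (s - 1) x := by
  have hd : ∀ t ∈ Set.Ici x, HasDerivAt (fun t : ℝ => -(t ^ (s - 1) * Real.exp (-t)))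
      (t ^ (s - 1) * Real.exp (-t) - (s - 1) * (t ^ (s - 1 - 1) * Real.exp (-t))) t := by
    intro t ht
    have ht0 : 0 < t := hx.trans_le ht
    have h1 := (Real.hasDerivAt_rpow_const (x := t) (p := s - 1) (Or.inl ht0.ne')).mul
      ((hasDerivAt_neg t).exp)
    exact h1.neg.congr_deriv (by ring)
  have hi1 := integrableOn_upperGamma s hx
  have hi2 := (integrableOn_upperGamma (s - 1) hx).const_mul (s - 1)
  have hlim : Tendsto (fun t : ℝ => -(t ^ (s - 1) * Real.exp (-t))) atTop (𝓝 0) := by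
    rw [← neg_zero]
    have h := tendsto_rpow_mul_exp_neg_mul_atTop_nhds_zero (s - 1) 1 one_pos
    simp only [neg_mul, one_mul] at h
    exact h.neg
  have h := integral_Ioi_of_hasDerivAt_of_tendsto' hd (hi1.sub hi2) hlim
  rw [integral_sub hi1 hi2, integral_const_mul] at h
  simp only [upperGamma]
  linarith

/-- `x^(s-1) e^(-x) ~ Γ(s,x)` as `x → ∞`. -/
lemma tendsto_rpow_mul_exp_div_upperGamma {s : ℝ} (hs : 1 ≤ s) :
    Tendsto (fun x => x ^ (s - 1) * Real.exp (-x) / upperGamma s x) atTop (𝓝 1) := by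
  have hl : Tendsto (fun x : ℝ => 1 - (s - 1) * x⁻¹) atTop (𝓝 1) := by
    simpa using (tendsto_inv_atTop_zero.const_mul (s - 1)).const_sub 1
  refine tendsto_of_tendsto_of_tendsto_of_le_of_le' hl tendsto_const_nhds ?_ ?_
  all_goals
    filter_upwards [eventually_gt_atTop 0] with x hx
    have h1 := upperGamma_rec s hx
    have h2 := upperGamma_nonneg (s - 1) hx
    have h3 : 0 < x ^ (s - 1) * Real.exp (-x) := by positivity
    have h4 : 0 ≤ (s - 1) * upperGamma (s - 1) x := mul_nonneg (by linarith) h2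
    have h5 : 0 < upperGamma s x := by linarith
  · rw [le_div_iff₀ h5]
    have h6 := upperGamma_le_rpow_mul (show s - 1 ≤ s by linarith) hx
    rw [show s - 1 - s = -1 by ring, Real.rpow_neg_one] at h6
    have h7 := mul_le_mul_of_nonneg_left h6 (show 0 ≤ s - 1 by linarith)
    linarith
  · rw [div_le_one h5]
    linarith

lemma upperGamma_pos {s : ℝ} (hs : 1 ≤ s) {x : ℝ} (hx : 0 < x) : 0 < upperGamma s x := by
  have h2 := upperGamma_nonneg (s - 1) hx
  have h3 : 0 < x ^ (s - 1) * Real.exp (-x) := by positivity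
  have h4 : 0 ≤ (s - 1) * upperGamma (s - 1) x := mul_nonneg (by linarith) h2
  rw [upperGamma_rec s hx]
  linarith

lemma tendsto_upperGamma_ratio {s s' : ℝ} (hs' : 1 ≤ s') (h : s < s') :
    Tendsto (fun x => upperGamma s x / upperGamma s' x) atTop (𝓝 0) := by
  have hl : Tendsto (fun x : ℝ => x ^ (s - s')) atTop (𝓝 0) := by
    have := tendsto_rpow_neg_atTop (show 0 < s' - s by linarith)
    simpa using this
  refine tendsto_of_tendsto_of_tendsto_of_le_of_le' tendsto_const_nhds hl ?_ ?_
  all_goals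
    filter_upwards [eventually_gt_atTop 0] with x hx
    have h1 := upperGamma_nonneg s hx
    have h2 := upperGamma_pos hs' hx
  · positivity
  · rw [div_le_iff₀ h2]
    exact upperGamma_le_rpow_mul h.le hx

lemma tendsto_upperGamma_shift_ratio {s s' : ℝ} (hs' : 1 ≤ s') (h : s < s') :
    Tendsto (fun x => upperGamma s (1 + x) / upperGamma s' x) atTop (𝓝 0) := by
  refine tendsto_of_tendsto_of_tendsto_of_le_of_le' tendsto_const_nhds
    (tendsto_upperGamma_ratio hs' h) ?_ ?_
  all_goals
    filter_upwards [eventually_gt_atTop 0] with x hx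
    have h1 := upperGamma_nonneg s (show 0 < 1 + x by linarith)
    have h2 := upperGamma_pos hs' hx
  · positivity
  · have := upperGamma_anti s hx (show x ≤ 1 + x by linarith)
    gcongr

/-- The bound on the capacity of one user is asymptotically the logarithm of the threshold. -/
lemma tendsto_userBound_div_log {r j : ℕ} (hj2 : 2 ≤ j) (hjr : j ≤ r) :
    Tendsto (fun u => userBound r j u / Real.log u) atTop (𝓝 1) := by
  have hr : (1 : ℝ) ≤ r := by exact_mod_cast (by omega : 1 ≤ r)
  have hj : (2 : ℝ) ≤ j := by exact_mod_cast hj2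
  have hx : Tendsto (fun u : ℝ => u / 2) atTop atTop := tendsto_id.atTop_div_const two_pos
  have ha := (tendsto_rpow_mul_exp_div_upperGamma hr).comp hx
  have hg1 := (tendsto_upperGamma_ratio hr (show (r : ℝ) - j + 1 < r by linarith)).comp hx
  have hg2 := (tendsto_upperGamma_shift_ratio hr (show (r : ℝ) - j < r by linarith)).comp hx
  have hlog : Tendsto (fun u : ℝ => (Real.log u)⁻¹) atTop (𝓝 0) :=
    tendsto_inv_atTop_zero.comp Real.tendsto_log_atTop
  set c := Real.Gamma r / Real.Gamma ((r : ℝ) - j + 1) with hc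
  set d := realDigamma ((r : ℝ) - j + 1) - realDigamma r with hd
  -- After division by `log u` only `x^(r-1) e^{-x} / Γ(r, x)` at `x = u / 2` survives, with limit
  -- 1: the first Gamma ratio tends to 0, and the terms without `log u` are bounded.
  have hmain := ((hg1.const_mul c).add ha).add
    (((ha.mul_const d).add ((hg2.const_mul c).const_mul (Real.exp 1))).mul hlog)
  simp only [mul_zero, zero_add, add_zero] at hmain
  refine hmain.congr' ?_
  filter_upwards [eventually_gt_atTop 1] with u hu
  have hl : Real.log u ≠ 0 := (Real.log_pos hu).ne'
  have hx0 : 0 < u / 2 := by linarith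
  have hG := (upperGamma_pos hr hx0).ne'
  have e1 : Real.exp (-(u / 2)) * (u ^ (r - 1) / (2 ^ (r - 1) * upperGamma r (u / 2)))
      = (u / 2) ^ ((r : ℝ) - 1) * Real.exp (-(u / 2)) / upperGamma r (u / 2) := by
    have : (u / 2) ^ ((r : ℝ) - 1) = u ^ (r - 1) / 2 ^ (r - 1) := by
      rw [← div_pow, ← Real.rpow_natCast, Nat.cast_sub (by omega), Nat.cast_one]
    rw [this]
    field_simp
  simp only [Function.comp_apply, userBound]
  rw [e1, ← hd, mul_comm (upperGamma (r : ℝ) (u / 2)),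
    mul_div_mul_comm, mul_div_mul_comm, ← hc]
  field_simp
  ring

/-! ### Binomial versus Poisson weights, uniformly in `k ≤ M`. -/

lemma exp_neg_div_one_sub_le {y : ℝ} (hy : y < 1) : Real.exp (-(y / (1 - y))) ≤ 1 - y := by
  have h : 0 < 1 - y := by linarith
  have h1 := Real.add_one_le_exp (y / (1 - y))
  have h2 : y / (1 - y) + 1 = (1 - y)⁻¹ := by field_simp; ring
  rw [h2] at h1
  rw [Real.exp_neg]
  exact inv_le_of_inv_le₀ h h1

/-- Raise the preceding bound at `y = k / K` to the power `K`: the exponent is `-kK / (K - k) = -k -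
k² / (K - k)`, and the error is largest at `k = M`. -/
lemma exp_neg_mul_le_one_sub_div_pow {K : ℕ} {k M : ℝ} (hk : 0 < k) (hkM : k ≤ M) (hMK : M < K) :
    Real.exp (-k) * Real.exp (-(M ^ 2 / (K - M))) ≤ (1 - k / K) ^ K := by
  have hK : (0 : ℝ) < K := by linarith
  have hkK : k / K < 1 := by rw [div_lt_one hK]; linarith
  have h1 : (0 : ℝ) < K - k := by linarith
  have h2 : (0 : ℝ) < K - M := by linarith
  calc _ ≤ Real.exp (-k) * Real.exp (-(k ^ 2 / (K - k))) := by
        gcongr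
    _ = Real.exp (-(k / K / (1 - k / K))) ^ K := by
        rw [← Real.exp_add, ← Real.exp_nat_mul]
        congr 1
        have : 1 - k / K = (K - k) / K := by field_simp
        rw [this]
        field_simp
        ring
    _ ≤ _ := pow_le_pow_left₀ (Real.exp_pos _).le (exp_neg_div_one_sub_le hkK) K

/-- Uniform lower bound of binomial by Poisson probabilities. -/
lemma eventually_poisson_le_binomial (r : ℕ) {M ε : ℝ} (hε : 0 < ε) :
    ∀ᶠ K : ℕ in atTop, ∀ k : ℝ, 0 < k → k ≤ M → ∀ j ≤ r,
      (1 - ε) * (k ^ j * Real.exp (-k) / (j.factorial : ℝ))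
        ≤ (K.choose j : ℝ) * (k / K) ^ j * (1 - k / K) ^ (K - j) := by
  have hlim : Tendsto (fun K : ℕ => (1 - (r : ℝ) / K) ^ r * Real.exp (-(M ^ 2 / ((K : ℝ) - M))))
      atTop (𝓝 1) := by
    have h1 : Tendsto (fun K : ℕ => (1 - (r : ℝ) / K) ^ r) atTop (𝓝 1) := by
      simpa using ((tendsto_const_div_atTop_nhds_zero_nat (r : ℝ)).const_sub 1).pow r
    have h2 : Tendsto (fun K : ℕ => M ^ 2 / ((K : ℝ) - M)) atTop (𝓝 0) :=
      (tendsto_atTop_add_const_right _ (-M) tendsto_natCast_atTop_atTop).const_div_atTop _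
    have h3 := (Real.continuous_exp.tendsto _).comp h2.neg
    simp only [neg_zero, Real.exp_zero] at h3
    simpa using h1.mul h3
  filter_upwards [hlim.eventually (lt_mem_nhds (show 1 - ε < 1 by linarith)),
    eventually_ge_atTop (r + 1), tendsto_natCast_atTop_atTop.eventually_gt_atTop M]
    with K hK hKr hKM k hk hkM j hj
  have hK0 : (0 : ℝ) < K := by exact_mod_cast (by omega : 0 < K)
  have hkK : k / K < 1 := by rw [div_lt_one hK0]; linarith
  have hkK0 : 0 ≤ k / K := by positivity
  have hrK : (r : ℝ) / K ≤ 1 := by rw [div_le_one hK0]; exact_mod_cast (by omega : r ≤ K)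
  have hrK0 : 0 ≤ (r : ℝ) / K := by positivity
  have hfac : (0 : ℝ) < (j.factorial : ℝ) := by exact_mod_cast j.factorial_pos
  -- The product `j! · choose K j` is a descending factorial of `j` factors, each at least `K - r`.
  have hchoose : (1 - (r : ℝ) / K) ^ r * (k ^ j / (j.factorial : ℝ)) ≤ K.choose j * (k / K) ^ j := by
    have h1 : ((K : ℝ) - r) ^ j ≤ K.choose j * j.factorial := by
      have h2 : (K - r) ^ j ≤ K.choose j * j.factorial := by
        rw [mul_comm, ← Nat.descFactorial_eq_factorial_mul_choose]
        exact (Nat.pow_le_pow_left (by omega) j).trans (Nat.pow_sub_le_descFactorial K j)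
      have h3 : (((K - r) ^ j : ℕ) : ℝ) ≤ ((K.choose j * j.factorial : ℕ) : ℝ) := by
        exact_mod_cast h2
      rw [Nat.cast_pow, Nat.cast_sub (by omega)] at h3
      push_cast at h3
      exact h3
    calc _ ≤ (1 - (r : ℝ) / K) ^ j * (k ^ j / (j.factorial : ℝ)) := by
          have := pow_le_pow_of_le_one (show 0 ≤ 1 - (r : ℝ) / K by linarith)
            (by linarith) hj
          gcongr
      _ = ((K : ℝ) - r) ^ j / j.factorial * (k / K) ^ j := by
          have : 1 - (r : ℝ) / K = (K - r) / K := by field_simp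
          rw [this, div_pow, div_pow]
          field_simp
      _ ≤ _ := by
          gcongr
          rw [div_le_iff₀ hfac]
          exact h1
  have hpow : Real.exp (-k) * Real.exp (-(M ^ 2 / (K - M))) ≤ (1 - k / K) ^ (K - j) :=
    (exp_neg_mul_le_one_sub_div_pow hk hkM hKM).trans
      (pow_le_pow_of_le_one (by linarith) (by linarith) (Nat.sub_le K j))
  calc _ ≤ ((1 - (r : ℝ) / K) ^ r * Real.exp (-(M ^ 2 / ((K : ℝ) - M))))
        * (k ^ j * Real.exp (-k) / (j.factorial : ℝ)) := by
        have := hK.le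
        gcongr
    _ = ((1 - (r : ℝ) / K) ^ r * (k ^ j / (j.factorial : ℝ)))
        * (Real.exp (-k) * Real.exp (-(M ^ 2 / ((K : ℝ) - M)))) := by ring
    _ ≤ _ := by
        have : 0 ≤ 1 - k / K := by linarith
        gcongr

/-! ### The order of magnitude of the threshold. -/

lemma one_le_truncExp {r : ℕ} (hr : 1 ≤ r) {u : ℝ} (hu : 0 ≤ u) : 1 ≤ truncExp r u := by
  obtain ⟨m, rfl⟩ := Nat.exists_eq_add_of_le' hr
  rw [← truncExp_succ_zero m]
  exact truncExp_mono _ le_rfl hu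

/-- Writing `(u/2)^i = 2^i (u/4)^i` costs a factor `2^r` but leaves decay `e^{-u/4}` in the tail,
enough for an upper bound on `u` linear in `log K`. -/
lemma truncExp_le (r : ℕ) {u : ℝ} (hu : 0 ≤ u) : truncExp r u ≤ 2 ^ r * Real.exp (u / 4) := by
  calc truncExp r u ≤ ∑ i ∈ Finset.range r, 2 ^ r * ((u / 4) ^ i / (i.factorial : ℝ)) := by
        refine Finset.sum_le_sum fun i hi => ?_
        have h1 : (2 : ℝ) ^ i ≤ 2 ^ r := pow_le_pow_right₀ one_le_two (Finset.mem_range.1 hi).le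
        have h2 : (u / 2) ^ i = 2 ^ i * (u / 4) ^ i := by rw [← mul_pow]; congr 1; ring
        rw [h2, mul_div_assoc]
        gcongr
    _ ≤ _ := by
        rw [← Finset.mul_sum]
        gcongr
        exact Real.sum_le_exp_of_nonneg (by positivity) r

/-- The threshold exceeded by `k` users on average is of order `log K`. -/
lemma threshold_bounds {K r : ℕ} (hr : 1 ≤ r) {k u : ℝ} (hk : 0 < k) (hkK : k < K)
    (h : expectedExceedances K r u = k) :
    0 ≤ u ∧ 2 * (Real.log K - Real.log k) ≤ u ∧
      u ≤ 4 * (Real.log K - Real.log k) + 4 * r * Real.log 2 := by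
  have hK : (0 : ℝ) < K := hk.trans hkK
  rw [expectedExceedances_eq] at h
  -- A negative threshold is exceeded by everyone, which would force `k = K`.
  have hu : 0 ≤ u := by
    by_contra hu
    rw [exceedProb, gainTail_of_neg r (not_le.1 hu)] at h
    simp only [ENNReal.toReal_one, mul_one] at h
    linarith
  rw [exceedProb_eq r hu] at h
  have hlow : K * Real.exp (-(u / 2)) ≤ k := by
    have h1 := one_le_truncExp hr hu
    have h2 : 0 < K * Real.exp (-(u / 2)) := by positivity
    nlinarith
  have hup : k ≤ K * (2 ^ r * Real.exp (-(u / 4))) := by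
    have h1 := truncExp_le r hu
    have h2 : Real.exp (-(u / 4)) = Real.exp (-(u / 2)) * Real.exp (u / 4) := by
      rw [← Real.exp_add]; congr 1; ring
    rw [← h, h2]
    calc _ ≤ K * (Real.exp (-(u / 2)) * (2 ^ r * Real.exp (u / 4))) := by gcongr
      _ = _ := by ring
  refine ⟨hu, ?_, ?_⟩
  · have := Real.log_le_log (by positivity) hlow
    rw [Real.log_mul hK.ne' (Real.exp_pos _).ne', Real.log_exp] at this
    linarith
  · have := Real.log_le_log hk hup
    rw [Real.log_mul hK.ne' (by positivity), Real.log_mul (by positivity) (Real.exp_pos _).ne',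
      Real.log_exp, Real.log_pow] at this
    linarith

lemma tendsto_threshold {r : ℕ} (hr : 1 ≤ r) {k : ℝ} (hk : 0 < k) {u : ℕ → ℝ}
    (hu : ∀ᶠ K in atTop, expectedExceedances K r (u K) = k) : Tendsto u atTop atTop := by
  have h1 : Tendsto (fun K : ℕ => 2 * (Real.log K - Real.log k)) atTop atTop :=
    (tendsto_atTop_add_const_right _ (-Real.log k)
      (Real.tendsto_log_atTop.comp tendsto_natCast_atTop_atTop)).const_mul_atTop two_pos
  refine tendsto_atTop_mono' _ ?_ h1
  filter_upwards [hu, tendsto_natCast_atTop_atTop.eventually_gt_atTop k] with K hK hkK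
  exact (threshold_bounds hr hk hkK hK).2.1

lemma isTheta_log_threshold {r : ℕ} (hr : 1 ≤ r) {k : ℝ} (hk : 0 < k) {u : ℕ → ℝ}
    (hu : ∀ᶠ K in atTop, expectedExceedances K r (u K) = k) :
    (fun K => Real.log (u K)) =Θ[atTop] (fun K : ℕ => Real.log (Real.log (K : ℝ))) := by
  have hlogK : Tendsto (fun K : ℕ => Real.log (K : ℝ)) atTop atTop :=
    Real.tendsto_log_atTop.comp tendsto_natCast_atTop_atTop
  have hll : Tendsto (fun K : ℕ => Real.log (Real.log (K : ℝ))) atTop atTop :=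
    Real.tendsto_log_atTop.comp hlogK
  have hev : ∀ᶠ K : ℕ in atTop, 0 ≤ Real.log (Real.log (K : ℝ)) ∧
      Real.log (Real.log (K : ℝ)) ≤ Real.log (u K) ∧
      Real.log (u K) ≤ 2 * Real.log (Real.log (K : ℝ)) := by
    -- These conditions turn the threshold bounds into `log K ≤ u ≤ 5 log K`, and make `log 5` at
    -- most `log log K`.
    filter_upwards [hu, tendsto_natCast_atTop_atTop.eventually_gt_atTop k,
      hlogK.eventually_ge_atTop 1, hlogK.eventually_ge_atTop (2 * Real.log k),
      hlogK.eventually_ge_atTop (-4 * Real.log k + 4 * r * Real.log 2),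
      hll.eventually_ge_atTop (Real.log 5)] with K h1 h2 h3 h4 h5 h6
    obtain ⟨-, h7, h8⟩ := threshold_bounds hr hk h2 h1
    have h9 : 0 < Real.log (K : ℝ) := by linarith
    refine ⟨Real.log_nonneg h3, Real.log_le_log h9 (by linarith), ?_⟩
    calc Real.log (u K) ≤ Real.log (5 * Real.log K) :=
          Real.log_le_log (by linarith) (by linarith)
      _ = Real.log 5 + Real.log (Real.log K) := Real.log_mul (by norm_num) h9.ne'
      _ ≤ _ := by linarith
  constructor
  · refine IsBigO.of_bound 2 ?_
    filter_upwards [hev] with K ⟨h1, h2, h3⟩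
    rwa [Real.norm_of_nonneg h1, Real.norm_of_nonneg (h1.trans h2)]
  · refine IsBigO.of_bound 1 ?_
    filter_upwards [hev] with K ⟨h1, h2, h3⟩
    rwa [Real.norm_of_nonneg h1, Real.norm_of_nonneg (h1.trans h2), one_mul]

/-! ### Growth orders and the final comparison. -/

lemma isTheta_log_of_tendsto_div {f : ℝ → ℝ} {c : ℝ} (hc : c ≠ 0)
    (hf : Tendsto (fun u => f u / Real.log u) atTop (𝓝 c)) : f =Θ[atTop] Real.log := by
  have hne : ∀ᶠ u in atTop, Real.log u ≠ 0 := by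
    filter_upwards [eventually_gt_atTop 1] with u hu using (Real.log_pos hu).ne'
  refine ⟨isBigO_of_div_tendsto_nhds (by filter_upwards [hne] with u h1 h2 using absurd h2 h1) c hf,
    ?_⟩
  have h2 := hf.inv₀ hc
  have hfne : ∀ᶠ u in atTop, f u ≠ 0 := by
    filter_upwards [hf.eventually_ne hc] with u h1 h2
    simp [h2] at h1
  refine isBigO_of_div_tendsto_nhds (by filter_upwards [hfne] with u h1 h2 using absurd h2 h1) c⁻¹ ?_
  refine h2.congr fun u => ?_
  simp

lemma tendsto_capacityLowerBound_div_log (r : ℕ) (k : ℝ) :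
    Tendsto (fun u => capacityLowerBound r k u / Real.log u) atTop
      (𝓝 (∑ j ∈ Finset.Icc 2 r, k ^ j * Real.exp (-k) / (j.factorial : ℝ) * j)) := by
  have h : Tendsto (fun u => ∑ j ∈ Finset.Icc 2 r, k ^ j * Real.exp (-k) / (j.factorial : ℝ) * j
      * (userBound r j u / Real.log u)) atTop
      (𝓝 (∑ j ∈ Finset.Icc 2 r, k ^ j * Real.exp (-k) / (j.factorial : ℝ) * j * 1)) :=
    tendsto_finsetSum _ fun j hj =>
      (tendsto_userBound_div_log (Finset.mem_Icc.1 hj).1 (Finset.mem_Icc.1 hj).2).const_mul _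
  simp only [mul_one] at h
  refine h.congr fun u => ?_
  rw [capacityLowerBound, Finset.sum_div]
  exact Finset.sum_congr rfl fun j _ => (mul_div_assoc _ _ _).symm

/-- The weights with at least two users are dominated by the single-user weight. -/
lemma sum_poisson_weights_le (r : ℕ) {k M : ℝ} (hk : 0 < k) (hkM : k ≤ M) :
    ∑ j ∈ Finset.Icc 2 r, k ^ j * Real.exp (-k) / (j.factorial : ℝ) * j
      ≤ Real.exp M * (k * Real.exp (-k)) := by
  have h1 : ∀ j ∈ Finset.Icc 2 r, k ^ j * Real.exp (-k) / (j.factorial : ℝ) * j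
      = k * Real.exp (-k) * (k ^ (j - 1) / ((j - 1).factorial : ℝ)) := by
    intro j hj
    obtain ⟨i, rfl⟩ := Nat.exists_eq_add_of_le' (show 1 ≤ j by
      have := (Finset.mem_Icc.1 hj).1; omega)
    rw [Nat.add_sub_cancel, Nat.factorial_succ]
    push_cast
    field_simp
    ring
  rw [Finset.sum_congr rfl h1, ← Finset.mul_sum, mul_comm]
  gcongr
  calc ∑ j ∈ Finset.Icc 2 r, k ^ (j - 1) / ((j - 1).factorial : ℝ)
      ≤ ∑ j ∈ Finset.Icc 1 r, k ^ (j - 1) / ((j - 1).factorial : ℝ) := by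
        refine Finset.sum_le_sum_of_subset_of_nonneg (Finset.Icc_subset_Icc_left one_le_two)
          fun j _ _ => by positivity
    _ = ∑ i ∈ Finset.range r, k ^ i / (i.factorial : ℝ) := by
        rw [Finset.range_eq_Ico, ← Finset.Ico_succ_right_eq_Icc]
        exact (Finset.sum_Ico_add' (fun j => k ^ (j - 1) / ((j - 1).factorial : ℝ)) 0 r 1).symm
    _ ≤ Real.exp k := Real.sum_le_exp_of_nonneg hk.le r
    _ ≤ Real.exp M := Real.exp_le_exp.2 hkM

/-- Here `a` is the single-user weight and `T` the weight of two or more users. The three factors `1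
- ε` pay for the bad SINR event, for `log (1 + δu)` against `log u`, and for binomial against
Poisson; `1 + ε` pays for `B_j` against `log u`. -/
lemma weight_comparison {ε a T : ℝ} (hε : 0 < ε) (hε8 : ε ≤ 1 / 8) (ha : 0 < a) (hT : 0 ≤ T)
    (hεT : ε * T ≤ a / 8) : (1 + ε) * T < (1 - ε) * (1 - ε) * ((1 - ε) * (a + T)) := by
  have h1 : 0 ≤ ε ^ 2 * (3 - ε) := mul_nonneg (sq_nonneg ε) (by linarith)
  have h2 : 1 - 3 * ε ≤ (1 - ε) * (1 - ε) * (1 - ε) := by linarith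
  have h3 : ε * a ≤ 1 / 8 * a := by gcongr
  calc (1 + ε) * T < (1 - 3 * ε) * (a + T) := by linarith
    _ ≤ (1 - ε) * (1 - ε) * (1 - ε) * (a + T) := by gcongr
    _ = _ := by ring

theorem capacityLowerBound_lt_expectedCapacity (r : ℕ) (hr : 1 ≤ r) {M : ℝ} (hM : 0 < M) :
    ∃ K₀ : ℕ, ∀ K : ℕ, K₀ ≤ K → ∀ k : ℝ, 0 < k → k ≤ M →
      ∀ u : ℝ, expectedExceedances K r u = k →
        capacityLowerBound r k u < expectedCapacity K r 1 u := by
  -- Chosen so that `T ≤ e^M a` gives `ε T ≤ a / 8`, whatever `k ≤ M`.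
  set ε : ℝ := 1 / (8 * Real.exp M) with hεdef
  have hεM : ε * Real.exp M = 1 / 8 := by rw [hεdef]; field_simp
  have hε : 0 < ε := by positivity
  have hε8 : ε ≤ 1 / 8 := by
    rw [hεdef]
    exact one_div_le_one_div_of_le (by norm_num) (by linarith [Real.one_le_exp hM.le])
  have hr0 : (1 : ℝ) ≤ r := by exact_mod_cast hr
  -- The bad SINR event then has conditional probability at most `r δ = ε`.
  set δ : ℝ := ε / r with hδdef
  have hδ : 0 < δ := by positivity
  have hrδ : r * δ = ε := by rw [hδdef]; field_simp
  have hδ1 : δ ≤ 1 := (div_le_self hε.le hr0).trans (by linarith)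
  have hub : ∀ᶠ u in atTop, ∀ j ∈ Finset.Icc 2 r, userBound r j u ≤ (1 + ε) * Real.log u := by
    rw [Filter.eventually_all_finset]
    intro j hj
    filter_upwards [(tendsto_userBound_div_log (Finset.mem_Icc.1 hj).1
      (Finset.mem_Icc.1 hj).2).eventually (gt_mem_nhds (show 1 < 1 + ε by linarith)),
      eventually_gt_atTop 1] with u h1 h2
    exact ((div_lt_iff₀ (Real.log_pos h2)).1 h1).le
  have hlog : ∀ᶠ u in atTop, (1 - ε) * Real.log u ≤ Real.log (1 + δ * u) := by
    filter_upwards [(Real.tendsto_log_atTop.const_mul_atTop hε).eventually_ge_atTop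
      (-Real.log δ), eventually_gt_atTop 0] with u h1 h2
    calc _ ≤ Real.log δ + Real.log u := by linarith
      _ = Real.log (δ * u) := (Real.log_mul hδ.ne' h2.ne').symm
      _ ≤ _ := Real.log_le_log (by positivity) (by linarith)
  obtain ⟨U, hU⟩ := eventually_atTop.1 (hub.and (hlog.and (eventually_gt_atTop 1)))
  -- A lower bound for the threshold that does not depend on `k`, so that `K₀` depends only on `r`
  -- and `M`.
  have hT : Tendsto (fun K : ℕ => 2 * (Real.log K - Real.log M)) atTop atTop :=
    (tendsto_atTop_add_const_right _ (-Real.log M)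
      (Real.tendsto_log_atTop.comp tendsto_natCast_atTop_atTop)).const_mul_atTop two_pos
  obtain ⟨K₀, hK₀⟩ := eventually_atTop.1 ((eventually_poisson_le_binomial r (M := M) hε).and
    ((hT.eventually_ge_atTop U).and ((eventually_ge_atTop r).and
      (tendsto_natCast_atTop_atTop.eventually_gt_atTop M))))
  refine ⟨K₀, fun K hK k hk hkM u hu => ?_⟩
  obtain ⟨hbin, hKU, hKr, hKM⟩ := hK₀ K hK
  obtain ⟨hu0, hulow, -⟩ := threshold_bounds hr hk (by linarith) hu
  have hlogkM := Real.log_le_log hk hkM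
  obtain ⟨hub', hlog', hu1⟩ := hU u (by linarith)
  have hlogu : 0 < Real.log u := Real.log_pos hu1
  have hK0 : (0 : ℝ) < K := by linarith
  have hp : exceedProb r u = k / K := by
    rw [expectedExceedances_eq] at hu
    rw [← hu]; field_simp
  have hcap := expectedCapacity_ge hKr hu0 hδ.le hδ1 (by rw [hrδ]; linarith)
  rw [hrδ, hp] at hcap
  set w : ℕ → ℝ := fun j => k ^ j * Real.exp (-k) / (j.factorial : ℝ) * j with hw
  have hw0 : ∀ j, 0 ≤ w j := fun j => by positivity
  set T := ∑ j ∈ Finset.Icc 2 r, w j with hTdef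
  have hT0 : 0 ≤ T := Finset.sum_nonneg fun j _ => hw0 j
  have hTle : T ≤ Real.exp M * (k * Real.exp (-k)) := sum_poisson_weights_le r hk hkM
  set a := k * Real.exp (-k) with hadef
  have ha : 0 < a := by positivity
  have hsum : ∑ j ∈ Finset.Icc 1 r, w j = a + T := by
    rw [← Finset.add_sum_Ioc_eq_sum_Icc hr]
    congr 1
    simp [hw, hadef]
  have hlower : (1 - ε) * (a + T) ≤ ∑ j ∈ Finset.Icc 1 r,
      j * ((K.choose j : ℝ) * (k / K) ^ j * (1 - k / K) ^ (K - j)) := by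
    rw [← hsum, Finset.mul_sum]
    refine Finset.sum_le_sum fun j hj => ?_
    have := mul_le_mul_of_nonneg_left (hbin k hk hkM j (Finset.mem_Icc.1 hj).2)
      (Nat.cast_nonneg (α := ℝ) j)
    simp only [hw]
    linarith
  have hupper : capacityLowerBound r k u ≤ (1 + ε) * Real.log u * T := by
    rw [capacityLowerBound, hTdef, Finset.mul_sum]
    refine Finset.sum_le_sum fun j hj => ?_
    rw [mul_comm ((1 + ε) * Real.log u)]
    exact mul_le_mul_of_nonneg_left (hub' j hj) (hw0 j)
  have hε1 : 0 < 1 - ε := by linarith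
  have hεT : ε * T ≤ a / 8 := by
    calc ε * T ≤ ε * (Real.exp M * a) := by gcongr
      _ = (ε * Real.exp M) * a := by ring
      _ = a / 8 := by rw [hεM]; ring
  have hkey := weight_comparison hε hε8 ha hT0 hεT
  calc capacityLowerBound r k u ≤ (1 + ε) * Real.log u * T := hupper
    _ = Real.log u * ((1 + ε) * T) := by ring
    _ < Real.log u * ((1 - ε) * (1 - ε) * ((1 - ε) * (a + T))) := by gcongr
    _ = (1 - ε) * ((1 - ε) * Real.log u) * ((1 - ε) * (a + T)) := by ring
    _ ≤ (1 - ε) * Real.log (1 + δ * u) * ((1 - ε) * (a + T)) := by gcongr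
    _ ≤ (1 - ε) * Real.log (1 + δ * u) * ∑ j ∈ Finset.Icc 1 r,
      j * ((K.choose j : ℝ) * (k / K) ^ j * (1 - k / K) ^ (K - j)) := by
        have : 0 ≤ Real.log (1 + δ * u) := Real.log_nonneg (by
          linarith [mul_nonneg hδ.le hu0])
        gcongr
    _ ≤ _ := hcap

theorem mainTheorem6 (r : ℕ) (hr : 1 ≤ r) :
    (∀ M : ℝ, 0 < M → ∃ K₀ : ℕ, ∀ K : ℕ, K₀ ≤ K → ∀ k : ℝ, 0 < k → k ≤ M →
      ∀ u : ℝ, expectedExceedances K r u = k →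
        Integrable (fun H : Fin K → Fin r → ℂ => slotCapacity 1 u H) (channelLaw K r) ∧
        capacityLowerBound r k u < expectedCapacity K r 1 u) ∧
    (∀ k : ℝ, 0 < k → ∀ u : ℕ → ℝ, (∀ᶠ K in atTop, expectedExceedances K r (u K) = k) →
      (∀ j ∈ Finset.Icc 2 r,
        (fun K => userBound r j (u K)) =Θ[atTop] (fun K => Real.log (u K))) ∧
      (fun K => Real.log (u K)) =Θ[atTop] (fun K : ℕ => Real.log (Real.log (K : ℝ))) ∧
      (2 ≤ r → (fun K => capacityLowerBound r k (u K)) =Θ[atTop]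
        (fun K : ℕ => Real.log (Real.log (K : ℝ))))) := by
  refine ⟨fun M hM => ?_, fun k hk u hu => ?_⟩
  · obtain ⟨K₀, hK₀⟩ := capacityLowerBound_lt_expectedCapacity r hr hM
    exact ⟨K₀, fun K hK k hk hkM u hu =>
      ⟨integrable_slotCapacity K r u, hK₀ K hK k hk hkM u hu⟩⟩
  · have hlim := tendsto_threshold hr hk hu
    have hlog := isTheta_log_threshold hr hk hu
    have hcomp : ∀ f : ℝ → ℝ, f =Θ[atTop] Real.log →
        (fun K => f (u K)) =Θ[atTop] (fun K => Real.log (u K)) := fun f hf =>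
      ⟨hf.1.comp_tendsto hlim, hf.2.comp_tendsto hlim⟩
    refine ⟨fun j hj => hcomp _ (isTheta_log_of_tendsto_div one_ne_zero
      (tendsto_userBound_div_log (Finset.mem_Icc.1 hj).1 (Finset.mem_Icc.1 hj).2)), hlog,
      fun hr2 => (hcomp _ (isTheta_log_of_tendsto_div (ne_of_gt ?_)
        (tendsto_capacityLowerBound_div_log r k))).trans hlog⟩
    -- The limiting constant is positive because `r ≥ 2` makes the index range nonempty.
    refine Finset.sum_pos (fun j hj => ?_) ⟨2, Finset.mem_Icc.2 ⟨le_rfl, hr2⟩⟩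
    have : (0 : ℝ) < j := by
      have := (Finset.mem_Icc.1 hj).1
      exact_mod_cast (by omega : 0 < j)
    positivity
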